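/- A multigraph has labelled vertices and labelled oriented edges, loops and multiple edges being allowed; an $(n,m)$-multigraph has vertices $1,\dots,n$ and edges labelled $1,\dots,m$. The degree of a vertex is its number of half-edges (a loop counts twice). Two multigraphs are isomorphic if there are bijections between their vertices and between their edges that respect incidence (edge orientations may be reversed). For $D\subseteq\mathbb Z_{\ge 0}$, an $(n,m,D)$-multigraph is an $(n,m)$-multigraph all of whose degrees lie in $D$; $\operatorname{MG}_{n,m,D}$ is their number. Put $\Delta(x)=\sum_{d\in D}x^d/d!$. Let $\mathcal F$ be a family of finite multigraphs, let $\mathcal F_{n,m,(d_0,d_1,\dots)}$ be the number of $(n,m)$-multigraphs with exactly $d_j$ vertices of degree $j$ for all $j\ge0$ that are isomorphic to a member of $\mathcal F$, and let \[ F(z,w,(\delta_0,\delta_1,\dots))=\sum_{n,m,d_0,d_1,\dots}\mathcal F_{n,m,(d_0,d_1,\dots)}\Big(\prod_{s\ge0}\delta_s^{d_s}\Big)\frac{w^m}{2^m m!}\frac{z^n}{n!}. \] An $\mathcal F$-subgraph of $G$ is a subgraph of $G$ (a set of vertices together with a set of edges whose ends all lie in it) that is isomorphic to a member of $\mathcal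 F$. Let $N_{n,m}$ be the number of pairs $(G,H)$ where $G$ is an $(n,m,D)$-multigraph and $H$ is an $\mathcal F$-subgraph of $G$ (the $(n,m,D)$-multigraphs with one distinguished $\mathcal F$-subgraph). (1) For all $n,m\ge0$, as an identity on formal power series, \[ N_{n,m}=n!\,2^m m!\,[z^n w^m]\sum_{j\ge0}(2j)!\,[x^{2j}]\,F\big(z,w,(\Delta(x),\Delta'(x),\Delta''(x),\dots)\big)\,e^{z\Delta(x)}\,\frac{w^j}{2^j j!}. \] (2) Suppose that $D$ has at least two elements, that $\gcd(d-\min D\mid d\in D)=1$, and that $m=m(n)$ is such that $2m/n$ tends to a limit $\lambda$ with $\min D<\lambda<\sup D$ ($\sup D=\infty$ being allowed). For $t\in(\min D,\sup D)$ let $\chi(t)$ be the unique positive solution of $\chi\Delta'(\chi)/\Delta(\chi)=t$, and write $\chi=\chi(2m/n)$ (defined for all large $n$). Let $U=\{(z,w,x)\in\mathbb C^3:\Delta(x\,\chi(\lambda))\ne0\}$. Suppose that there is an analytic function $L$ on $U$ such that, for every compact $K\subset U$, for all large $n$ the double series over $(k,\ell)$, the exponents of $z$ and $w$, that defines the numerator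 below converges absolutely on $K$, and \[ \frac{F\Big(\frac{nz}{\Delta(x\chi)},\frac{w(x\chi)^2}{2m},(\Delta(x\chi),\Delta'(x\chi),\dots)\Big)}{F\Big(\frac{n}{\Delta(\chi)},\frac{\chi^2}{2m},(\Delta(\chi),\Delta'(\chi),\dots)\Big)}\longrightarrow L(z,w,x) \] uniformly on $K$ as $n\to\infty$. (If the denominator is $0$, the quotient is read as $0$.) Then, as $n\to\infty$, \[ N_{n,m}\sim\operatorname{MG}_{n,m,D}\;F\Big(\frac{n}{\Delta(\chi)},\frac{\chi^2}{2m},(\Delta(\chi),\Delta'(\chi),\dots)\Big). \] -/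

import Mathlib

open Filter Topology Asymptotics

noncomputable section

namespace DistinguishedSubgraph

/-- A multigraph with vertex labels `V` and edge labels `E`: every labelled edge is an oriented
pair of vertices; loops and multiple edges are allowed. An `(n, m)`-multigraph is a
`Multigraph (Fin n) (Fin m)`. -/
@[ext]
structure Multigraph (V E : Type) where
  ends : E → V × V

namespace Multigraph

variable {V E V' E' : Type}

/-- The degree of a vertex is its number of half-edges: a loop counts twice. -/
def degree (G : Multigraph V E) (v : V) : ℕ :=
  Nat.card {e : E // (G.ends e).1 = v} + Nat.card {e : E // (G.ends e).2 = v}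

/-- Isomorphism of multigraphs: a bijection of the vertices and a bijection of the edges that
respect incidence. Edge orientations may be reversed. -/
def Iso (G : Multigraph V E) (G' : Multigraph V' E') : Prop :=
  ∃ (f : V ≃ V') (g : E ≃ E'), ∀ e : E,
    s(f (G.ends e).1, f (G.ends e).2) = s((G'.ends (g e)).1, (G'.ends (g e)).2)

/-- A subgraph: a set of vertices and a set of edges that contains both ends of its edges. -/
@[ext]
structure Subgraph (G : Multigraph V E) where
  verts : Set V
  edges : Set E
  fst_mem : ∀ e ∈ edges, (G.ends e).1 ∈ verts
  snd_mem : ∀ e ∈ edges, (G.ends e).2 ∈ verts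

/-- A subgraph as a multigraph in its own right. -/
def Subgraph.toMultigraph {G : Multigraph V E} (H : G.Subgraph) :
    Multigraph H.verts H.edges where
  ends e := (⟨(G.ends e.1).1, H.fst_mem e.1 e.2⟩, ⟨(G.ends e.1).2, H.snd_mem e.1 e.2⟩)

end Multigraph

/-- A family of finite multigraphs. (It matters only up to isomorphism, so its members are
taken with vertex labels `Fin k` and edge labels `Fin l`.) -/
abbrev Family : Type := Set (Σ k : ℕ, Σ l : ℕ, Multigraph (Fin k) (Fin l))

/-- `G` is an `𝓕`-multigraph: it is isomorphic to a member of `𝓕`. -/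
def IsFamilyGraph (𝓕 : Family) {V E : Type} (G : Multigraph V E) : Prop :=
  ∃ F ∈ 𝓕, G.Iso F.2.2

/-! ### The objects that are counted -/

/-- The `(n, m, D)`-multigraphs: all degrees lie in `D`. -/
abbrev DegMultigraph (n m : ℕ) (D : Set ℕ) : Type :=
  {G : Multigraph (Fin n) (Fin m) // ∀ v, G.degree v ∈ D}

/-- The number `MG_{n,m,D}` of `(n, m, D)`-multigraphs. -/
def countMG (n m : ℕ) (D : Set ℕ) : ℕ := Nat.card (DegMultigraph n m D)

/-- The number of `(n, m, D)`-multigraphs in which one `𝓕`-subgraph is distinguished, i.e. of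
pairs of an `(n, m, D)`-multigraph and one of its `𝓕`-subgraphs. -/
def countDistinguished (𝓕 : Family) (n m : ℕ) (D : Set ℕ) : ℕ :=
  Nat.card (Σ G : DegMultigraph n m D, {H : G.1.Subgraph // IsFamilyGraph 𝓕 H.toMultigraph})

/-- The number `𝓕_{k,l,(d₀,d₁,…)}` of `(k, l)`-multigraphs that are isomorphic to a member of
`𝓕` and have exactly `d j` vertices of degree `j` for every `j`. -/
def familyCount (𝓕 : Family) (k l : ℕ) (d : ℕ →₀ ℕ) : ℕ :=
  Nat.card {G : Multigraph (Fin k) (Fin l) //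
    IsFamilyGraph 𝓕 G ∧ ∀ j : ℕ, Nat.card {v : Fin k // G.degree v = j} = d j}

/-! ### Formal generating functions

`R⟦X⟧⟦X⟧` is the ring of power series in `z` (outer variable) and `w` (inner variable). -/

open PowerSeries

/-- The coefficient of `z ^ k * w ^ l` in the generating function of `𝓕`, a polynomial in
`δ₀, δ₁, …`. For given `k`, `l` only finitely many `d` contribute. -/
def familyPoly (𝓕 : Family) (k l : ℕ) : MvPolynomial ℕ ℚ :=
  ∑ᶠ d : ℕ →₀ ℕ, MvPolynomial.monomial d
    ((familyCount 𝓕 k l d : ℚ) / (2 ^ l * l.factorial * k.factorial))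

/-- The generating function `F(z, w, (δ₀, δ₁, …))` of `𝓕`. -/
def familySeries (𝓕 : Family) : (MvPolynomial ℕ ℚ)⟦X⟧⟦X⟧ :=
  PowerSeries.mk fun k => PowerSeries.mk fun l => familyPoly 𝓕 k l

open Classical in
/-- `Δ(x) = ∑_{d ∈ D} x ^ d / d!` as a formal power series. -/
def deltaSeries (D : Set ℕ) : ℚ⟦X⟧ :=
  PowerSeries.mk fun d => if d ∈ D then 1 / (d.factorial : ℚ) else 0

/-- `F(z, w, (Δ(x), Δ'(x), Δ''(x), …))` as a power series in `z` and `w` over `ℚ⟦x⟧`. -/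
def familySeriesDelta (𝓕 : Family) (D : Set ℕ) : ℚ⟦X⟧⟦X⟧⟦X⟧ :=
  PowerSeries.map (PowerSeries.map
    (MvPolynomial.aeval fun s : ℕ =>
      (fun f : ℚ⟦X⟧ => PowerSeries.derivative ℚ f)^[s] (deltaSeries D)).toRingHom)
    (familySeries 𝓕)

/-- `exp (z * Δ(x))`. -/
def expZDelta (D : Set ℕ) : ℚ⟦X⟧⟦X⟧⟦X⟧ :=
  PowerSeries.rescale (PowerSeries.C (deltaSeries D)) (PowerSeries.exp (ℚ⟦X⟧⟦X⟧))

/-- `[x ^ i] A`, as a power series in `z` and `w`. -/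
def xCoeff (i : ℕ) (A : ℚ⟦X⟧⟦X⟧⟦X⟧) : ℚ⟦X⟧⟦X⟧ :=
  PowerSeries.mk fun n => PowerSeries.mk fun m =>
    PowerSeries.coeff i (PowerSeries.coeff m (PowerSeries.coeff n A))

/-- `∑_{j ≥ 0} (2j)! ([x ^ (2j)] A) * w ^ j / (2 ^ j * j!)`, a power series in `z` and `w`.
Because of the factor `w ^ j`, only finitely many `j` contribute to a given coefficient. -/
def halfEdgeSum (A : ℚ⟦X⟧⟦X⟧⟦X⟧) : ℚ⟦X⟧⟦X⟧ :=
  PowerSeries.mk fun n => PowerSeries.mk fun m =>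
    ∑ᶠ j : ℕ, ((2 * j).factorial : ℚ) *
      PowerSeries.coeff m (PowerSeries.coeff n
        (xCoeff (2 * j) A * PowerSeries.C ((PowerSeries.X : ℚ⟦X⟧) ^ j))) /
      (2 ^ j * j.factorial)

/-! ### Analytic functions -/

open Classical in
/-- `Δ(x) = ∑_{d ∈ D} x ^ d / d!` as an entire function. -/
def Delta (𝕜 : Type) [RCLike 𝕜] (D : Set ℕ) (x : 𝕜) : 𝕜 :=
  ∑' d : ℕ, if d ∈ D then x ^ d / (d.factorial : 𝕜) else 0

/-- The sequence `(Δ(x), Δ'(x), Δ''(x), …)`. -/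
def DeltaDerivs (𝕜 : Type) [RCLike 𝕜] (D : Set ℕ) (x : 𝕜) (s : ℕ) : 𝕜 :=
  iteratedDeriv s (Delta 𝕜 D) x

/-- The terms of the double series `F(z, w, (δ₀, δ₁, …))`. -/
def familyTerm {𝕜 : Type} [RCLike 𝕜] (𝓕 : Family) (z w : 𝕜) (δ : ℕ → 𝕜) (p : ℕ × ℕ) : 𝕜 :=
  MvPolynomial.aeval δ (familyPoly 𝓕 p.1 p.2) * w ^ p.2 * z ^ p.1

/-- The value of `F(z, w, (δ₀, δ₁, …))`, meaningful where the series converges absolutely. -/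
def familyValue {𝕜 : Type} [RCLike 𝕜] (𝓕 : Family) (z w : 𝕜) (δ : ℕ → 𝕜) : 𝕜 :=
  ∑' p : ℕ × ℕ, familyTerm 𝓕 z w δ p

/-- The positive solution `χ` of `χ Δ'(χ) / Δ(χ) = t`. It exists and is unique when `D` has at
least two elements and `min D < t < max D`; otherwise the value is irrelevant. -/
def chi (D : Set ℕ) (t : ℝ) : ℝ :=
  Classical.epsilon fun x : ℝ => 0 < x ∧ x * deriv (Delta ℝ D) x / Delta ℝ D x = t

/-- The arguments
`(n z / Δ(x χ), w (x χ)² / (2 m), (Δ(x χ), Δ'(x χ), …))` put into a function `Φ` of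
`(z, w, (δ₀, δ₁, …))`. -/
def atSaddle {𝕜 β : Type} [RCLike 𝕜] (Φ : 𝕜 → 𝕜 → (ℕ → 𝕜) → β) (D : Set ℕ) (n m : ℕ) (χ : 𝕜)
    (z w x : 𝕜) : β :=
  Φ ((n : 𝕜) * z / Delta 𝕜 D (x * χ)) (w * (x * χ) ^ 2 / (2 * (m : 𝕜)))
    (DeltaDerivs 𝕜 D (x * χ))

end DistinguishedSubgraph

end

/-! Exact formula. A pair (G, H) amounts to the vertex set S and edge set T of H, the multigraph H
on S and T, and the ends of the edges outside T. Once H is fixed, those ends are a function from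
labelled half-edges to vertices, and a vertex of degree s in H must receive a number of half-edges
in D − s. The exponential generating function of D − s is Δ⁽ˢ⁾, so `card_completions` counts the
completions by a coefficient of a product of derivatives of Δ. Summing over H substitutes (Δ, Δ', …)
into the generating function of the family, and `countDistinguished_eq` only keeps the sizes k = |S|
and l = |T|.

Asymptotics. Let χ be the saddle point and let d be drawn from D with Boltzmann weight χ^d / (d!
Δ(χ)), which has mean 2m/n. Then MG is an explicit factor times P(n draws sum to 2m). The number of
distinguished pairs is the same factor times a sum over (k, l, r) of the term of F with z^k w^l x^r,
multiplied by a correction: two quotients of factorials and powers, and P(n − k draws sum to 2m − 2l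
− r). It remains to replace every correction by P(n draws sum to 2m).

For fixed (k, l, r) this is a local limit theorem (`tendsto_sqrt_mul_sumProb`), proved by Fourier
inversion; the gcd condition yields the Gaussian decay of the characteristic function
(`norm_charFn_le`). For the tail, corrections grow at most geometrically in k and l, so
`correction_near` bounds the relative error by ε · 32^k 32^l 2^r. Since all coefficients are
nonnegative, summing this against F gives at most ε times F at enlarged real arguments, and the
convergence of the quotient at one such point bounds that by a constant times F at the saddle. -/

noncomputable section

namespace DistinguishedSubgraph

/-! ### Formal power series of degree sets -/

/-- The set `D` shifted down by `s`. -/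
def shift (s : ℕ) (D : Set ℕ) : Set ℕ := {e | e + s ∈ D}

theorem mem_shift {s e : ℕ} {D : Set ℕ} : e ∈ shift s D ↔ e + s ∈ D := Iff.rfl

theorem shift_zero (D : Set ℕ) : shift 0 D = D := rfl

theorem shift_shift (s t : ℕ) (D : Set ℕ) : shift s (shift t D) = shift (t + s) D := by
  ext e; simp [shift, add_assoc, add_comm t s]

/-- Differentiating an exponential generating function removes one labelled atom. Hence Δ⁽ˢ⁾
describes a vertex that already carries s half-edges. -/
theorem derivative_deltaSeries (D : Set ℕ) :
    PowerSeries.derivative ℚ (deltaSeries D) = deltaSeries (shift 1 D) := by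
  ext d
  have h : ((d.factorial : ℚ)) ≠ 0 := by positivity
  have h' : ((d : ℚ) + 1) ≠ 0 := by positivity
  simp only [PowerSeries.coeff_derivative, deltaSeries, PowerSeries.coeff_mk,
    Nat.factorial_succ]
  by_cases hd : d + 1 ∈ D
  · rw [if_pos hd, if_pos (mem_shift.2 hd)]; push_cast; field_simp
  · rw [if_neg hd, if_neg (mt mem_shift.1 hd), zero_mul]

theorem iterate_derivative_deltaSeries (D : Set ℕ) (s : ℕ) :
    (fun f : PowerSeries ℚ => PowerSeries.derivative ℚ f)^[s] (deltaSeries D) =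
      deltaSeries (shift s D) := by
  induction s with
  | zero => rfl
  | succ s ih =>
    rw [Function.iterate_succ_apply', ih, derivative_deltaSeries, shift_shift]

/-- The Leibniz rule with `Function.update`, so that in `card_fibres_fin` each summand is again a
product of `deltaSeries` with a single set shifted. -/
theorem derivative_prod_update {R ι : Type*} [CommRing R] [DecidableEq ι]
    (f : ι → PowerSeries R) (s : Finset ι) :
    PowerSeries.derivative R (∏ i ∈ s, f i) =
      ∑ i ∈ s, ∏ j ∈ s, Function.update f i (PowerSeries.derivative R (f i)) j := by
  induction s using Finset.induction_on with
  | empty => simp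
  | insert a s ha ih =>
    rw [Finset.prod_insert ha, Derivation.leibniz, ih, Finset.sum_insert ha,
      Finset.prod_insert ha, Function.update_self, smul_eq_mul, smul_eq_mul, add_comm]
    congr 1
    · rw [mul_comm]
      congr 1
      refine Finset.prod_congr rfl fun j hj => ?_
      rw [Function.update_of_ne (by rintro rfl; exact ha hj)]
    · rw [Finset.mul_sum]
      refine Finset.sum_congr rfl fun i hi => ?_
      rw [Finset.prod_insert ha, Function.update_of_ne (by rintro rfl; exact ha hi)]

/-! ### Counting functions with prescribed fibre sizes -/

theorem natCard_cons_fibre {V : Type} [DecidableEq V] {N : ℕ} (f : Fin N → V) (v w : V) :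
    Nat.card {h // (Fin.cons v f : Fin (N + 1) → V) h = w} =
      Nat.card {h // f h = w} + if v = w then 1 else 0 := by
  rw [Nat.card_eq_fintype_card, Nat.card_eq_fintype_card, Fintype.card_subtype,
    Fintype.card_subtype, Fin.card_filter_univ_succ]
  simp only [Fin.cons_zero, Fin.cons_succ]
  split_ifs <;> rfl

/-- Induction on N: removing the first point and its image v shifts the set `D v` by one. The sum
over v is the Leibniz rule for the product P, and (N + 1)! [x^(N+1)] P = N! [x^N] P'. -/
theorem card_fibres_fin {V : Type} [Fintype V] [DecidableEq V] (N : ℕ) (D : V → Set ℕ) :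
    (Nat.card {f : Fin N → V // ∀ v, Nat.card {h // f h = v} ∈ D v} : ℚ) =
      (N.factorial : ℚ) * PowerSeries.coeff N (∏ v, deltaSeries (D v)) := by
  classical
  induction N generalizing D with
  | zero =>
    have h0 : ∀ (f : Fin 0 → V) (v : V), Nat.card {h // f h = v} = 0 := fun f v => by
      simp
    simp only [h0]
    have : PowerSeries.coeff 0 (∏ v, deltaSeries (D v)) =
        ∏ v, if (0 : ℕ) ∈ D v then (1 : ℚ) else 0 := by
      rw [PowerSeries.coeff_zero_eq_constantCoeff_apply, map_prod]
      refine Finset.prod_congr rfl fun v _ => ?_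
      rw [← PowerSeries.coeff_zero_eq_constantCoeff_apply]
      simp [deltaSeries]
    rw [this]
    by_cases h : ∀ v, 0 ∈ D v
    · simp [h]
    · have : ∃ v, 0 ∉ D v := by simpa using h
      obtain ⟨v, hv⟩ := this
      rw [Finset.prod_eq_zero (Finset.mem_univ v) (by simp [hv])]
      simp [h]
  | succ N ih =>
    have e : {f : Fin (N + 1) → V // ∀ v, Nat.card {h // f h = v} ∈ D v} ≃
        Σ v : V, {f : Fin N → V // ∀ w, Nat.card {h // f h = w} ∈
          Function.update D v (shift 1 (D v)) w} := by
      refine ((Fin.consEquiv (fun _ : Fin (N + 1) => V)).symm.subtypeEquiv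
        (q := fun p => ∀ w, Nat.card {h // p.2 h = w} ∈
          Function.update D p.1 (shift 1 (D p.1)) w) ?_).trans ?_
      · intro f
        obtain ⟨⟨v, f⟩, rfl⟩ := (Fin.consEquiv (fun _ : Fin (N + 1) => V)).surjective f
        rw [Equiv.symm_apply_apply]
        refine forall_congr' fun w => ?_
        change Nat.card {h // (Fin.cons v f : Fin (N + 1) → V) h = w} ∈ D w ↔ _
        rw [natCard_cons_fibre]
        by_cases hw : v = w
        · subst hw; simp [shift]
        · simp [hw, Function.update_of_ne (Ne.symm hw)]
      · exact
        { toFun := fun p => ⟨p.1.1, p.1.2, p.2⟩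
          invFun := fun p => ⟨(p.1, p.2.1), p.2.2⟩
          left_inv := fun _ => rfl
          right_inv := fun _ => rfl }
    rw [Nat.card_congr e, Nat.card_sigma, Nat.cast_sum]
    simp only [ih]
    rw [← Finset.mul_sum, ← map_sum]
    have : ∑ v, ∏ w, deltaSeries (Function.update D v (shift 1 (D v)) w) =
        PowerSeries.derivative ℚ (∏ v, deltaSeries (D v)) := by
      rw [derivative_prod_update]
      refine Finset.sum_congr rfl fun v _ => Finset.prod_congr rfl fun w _ => ?_
      rw [derivative_deltaSeries]
      by_cases hw : w = v
      · subst hw; simp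
      · simp [hw]
    rw [this, PowerSeries.coeff_derivative, Nat.factorial_succ]
    push_cast; ring

theorem card_fibres {V H : Type} [Fintype V] [Finite H] (D : V → Set ℕ) :
    (Nat.card {f : H → V // ∀ v, Nat.card {h // f h = v} ∈ D v} : ℚ) =
      ((Nat.card H).factorial : ℚ) * PowerSeries.coeff (Nat.card H) (∏ v, deltaSeries (D v)) := by
  classical
  rw [← card_fibres_fin]
  congr 1
  refine Nat.card_congr (((Finite.equivFin H).arrowCongr (Equiv.refl V)).subtypeEquiv fun f => ?_)
  refine forall_congr' fun v => ?_
  rw [Nat.card_congr ((Finite.equivFin H).subtypeEquiv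
    (q := fun h => ((Finite.equivFin H).arrowCongr (Equiv.refl V)) f h = v) fun h => by simp)]

/-- The number of ways to choose the ends of the edges in `E`, when every vertex `v` has already
degree `c v` and its final degree has to lie in `D`. -/
theorem card_completions {V E : Type} [Fintype V] [Finite E] (c : V → ℕ) (D : Set ℕ) :
    (Nat.card {r : E → V × V // ∀ v, c v + (Nat.card {e // (r e).1 = v} +
        Nat.card {e // (r e).2 = v}) ∈ D} : ℚ) =
      ((2 * Nat.card E).factorial : ℚ) *
        PowerSeries.coeff (2 * Nat.card E) (∏ v, deltaSeries (shift (c v) D)) := by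
  -- The half-edges are `E ⊕ E`, first ends and second ends, so a loop counts twice at its vertex.
  have h2 : Nat.card (E ⊕ E) = 2 * Nat.card E := by rw [Nat.card_sum, two_mul]
  rw [← h2, ← card_fibres]
  congr 1
  refine Nat.card_congr (((Equiv.arrowProdEquivProdArrow E (fun _ => V) (fun _ => V)).trans
    (Equiv.sumArrowEquivProdArrow E E V).symm).subtypeEquiv fun r => ?_)
  refine forall_congr' fun v => ?_
  rw [Nat.card_congr (Equiv.subtypeSum (α := E) (β := E)), Nat.card_sum]
  change _ ↔ _ + c v ∈ D
  rw [add_comm]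
  rfl

/-! ### Families and isomorphisms -/

theorem Multigraph.Iso.trans {V E V' E' V'' E'' : Type} {G : Multigraph V E}
    {G' : Multigraph V' E'} {G'' : Multigraph V'' E''} (h : G.Iso G') (h' : G'.Iso G'') :
    G.Iso G'' := by
  obtain ⟨f, g, hfg⟩ := h
  obtain ⟨f', g', hfg'⟩ := h'
  refine ⟨f.trans f', g.trans g', fun e => ?_⟩
  have h1 := congrArg (Sym2.map f') (hfg e)
  simp only [Sym2.map_mk] at h1
  exact h1.trans (hfg' (g e))

/-- Relabelling the vertices and edges of a multigraph. -/
def Multigraph.relabel {V E V' E' : Type} (f : V ≃ V') (g : E ≃ E') :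
    Multigraph V E ≃ Multigraph V' E' where
  toFun G := ⟨fun e => (f (G.ends (g.symm e)).1, f (G.ends (g.symm e)).2)⟩
  invFun G := ⟨fun e => (f.symm (G.ends (g e)).1, f.symm (G.ends (g e)).2)⟩
  left_inv G := by ext <;> simp
  right_inv G := by ext <;> simp

theorem Multigraph.iso_relabel {V E V' E' : Type} (f : V ≃ V') (g : E ≃ E')
    (G : Multigraph V E) : G.Iso (Multigraph.relabel f g G) :=
  ⟨f, g, fun e => by simp [Multigraph.relabel]⟩

theorem Multigraph.relabel_iso {V E V' E' : Type} (f : V ≃ V') (g : E ≃ E')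
    (G : Multigraph V E) : (Multigraph.relabel f g G).Iso G :=
  ⟨f.symm, g.symm, fun e => by simp [Multigraph.relabel]⟩

theorem isFamilyGraph_relabel (𝓕 : Family) {V E V' E' : Type} (f : V ≃ V') (g : E ≃ E')
    (G : Multigraph V E) :
    IsFamilyGraph 𝓕 (Multigraph.relabel f g G) ↔ IsFamilyGraph 𝓕 G :=
  ⟨fun ⟨F, hF, h⟩ => ⟨F, hF, (Multigraph.iso_relabel f g G).trans h⟩,
    fun ⟨F, hF, h⟩ => ⟨F, hF, (Multigraph.relabel_iso f g G).trans h⟩⟩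

theorem degree_relabel {V E V' E' : Type} (f : V ≃ V') (g : E ≃ E')
    (G : Multigraph V E) (v : V) :
    (Multigraph.relabel f g G).degree (f v) = G.degree v := by
  unfold Multigraph.degree
  congr 1 <;>
  exact Nat.card_congr (g.symm.subtypeEquiv fun e => by simp [Multigraph.relabel])

instance {V E : Type} [Finite V] [Finite E] : Finite (Multigraph V E) :=
  Finite.of_injective Multigraph.ends fun _ _ h => Multigraph.ext h

/-- The sum over all `𝓕`-multigraphs `G` with vertex labels `V` and edge labels `E` of the
monomials `∏ v, δ_{deg v}`. -/
def degreePoly (𝓕 : Family) (V E : Type) [Fintype V] [Finite E] : MvPolynomial ℕ ℚ :=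
  ∑ᶠ G : {G : Multigraph V E // IsFamilyGraph 𝓕 G}, ∏ v, MvPolynomial.X (G.1.degree v)

/-- Used to pass from the vertex and edge sets of a subgraph to `Fin k` and `Fin l`. -/
theorem degreePoly_congr (𝓕 : Family) {V E V' E' : Type} [Fintype V] [Finite E]
    [Fintype V'] [Finite E'] (f : V ≃ V') (g : E ≃ E') :
    degreePoly 𝓕 V E = degreePoly 𝓕 V' E' := by
  unfold degreePoly
  refine finsum_eq_of_bijective ((Multigraph.relabel f g).subtypeEquiv fun G =>
    (isFamilyGraph_relabel 𝓕 f g G).symm) (Equiv.bijective _) fun G => ?_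
  refine Fintype.prod_equiv f _ _ fun v => ?_
  simp only [Equiv.subtypeEquiv_apply]
  rw [degree_relabel]

/-- The number of vertices of each degree. -/
def degreeCount {V E : Type} [Fintype V] (G : Multigraph V E) : ℕ →₀ ℕ :=
  ∑ v, Finsupp.single (G.degree v) 1

theorem degreeCount_apply {V E : Type} [Fintype V] (G : Multigraph V E) (j : ℕ) :
    degreeCount G j = Nat.card {v // G.degree v = j} := by
  classical
  rw [Nat.card_eq_fintype_card, Fintype.card_subtype, degreeCount, Finsupp.finsetSum_apply,
    Finset.card_filter]
  exact Finset.sum_congr rfl fun v _ => Finsupp.single_apply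

/-- Grouping the multigraphs by degree statistics: those with statistics d all give the same
monomial, and there are `familyCount 𝓕 k l d` of them. -/
theorem familyPoly_eq (𝓕 : Family) (k l : ℕ) :
    familyPoly 𝓕 k l = MvPolynomial.C (1 / ((2 : ℚ) ^ l * l.factorial * k.factorial)) *
      degreePoly 𝓕 (Fin k) (Fin l) := by
  classical
  have : Fintype {G : Multigraph (Fin k) (Fin l) // IsFamilyGraph 𝓕 G} := Fintype.ofFinite _
  have hcount : ∀ d : ℕ →₀ ℕ, familyCount 𝓕 k l d =
      (Finset.univ.filter fun G : {G : Multigraph (Fin k) (Fin l) // IsFamilyGraph 𝓕 G} =>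
        degreeCount G.1 = d).card := by
    intro d
    rw [← Fintype.card_subtype, ← Nat.card_eq_fintype_card, familyCount]
    refine (Nat.card_congr (Equiv.subtypeSubtypeEquivSubtypeInter _ _)).symm.trans
      (Nat.card_congr (Equiv.subtypeEquivRight fun G => ?_))
    simp only [DFunLike.ext_iff, degreeCount_apply]
  have hmon : ∀ G : Multigraph (Fin k) (Fin l),
      ∏ v, (MvPolynomial.X (G.degree v) : MvPolynomial ℕ ℚ) =
        MvPolynomial.monomial (degreeCount G) 1 := by
    intro G
    simp [degreeCount, MvPolynomial.monomial_sum_one, MvPolynomial.X]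
  unfold familyPoly degreePoly
  rw [finsum_eq_sum_of_fintype (α := {G : Multigraph (Fin k) (Fin l) // IsFamilyGraph 𝓕 G})]
  obtain ⟨ds, hds⟩ : ∃ ds : Finset (ℕ →₀ ℕ),
      ∀ G : {G : Multigraph (Fin k) (Fin l) // IsFamilyGraph 𝓕 G}, degreeCount G.1 ∈ ds :=
    ⟨Finset.univ.image fun G : {G : Multigraph (Fin k) (Fin l) // IsFamilyGraph 𝓕 G} =>
      degreeCount G.1, fun G => Finset.mem_image_of_mem (fun G : {G : Multigraph (Fin k) (Fin l) //
        IsFamilyGraph 𝓕 G} => degreeCount G.1) (Finset.mem_univ G)⟩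
  rw [finsum_eq_sum_of_support_subset (s := ds)]
  · rw [Finset.mul_sum, ← Finset.sum_fiberwise_of_maps_to (fun G _ => hds G)]
    refine Finset.sum_congr rfl fun d _ => ?_
    rw [Finset.sum_congr rfl (g := fun _ => MvPolynomial.monomial d
      (1 / ((2 : ℚ) ^ l * l.factorial * k.factorial)))]
    · rw [Finset.sum_const, ← hcount, ← map_nsmul]
      congr 1
      simp [div_eq_mul_inv]
    · intro G hG
      rw [Finset.mem_filter] at hG
      rw [hmon, MvPolynomial.C_mul_monomial, hG.2, mul_one]
  · intro d hd
    rw [Function.mem_support, hcount] at hd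
    by_contra hd'
    apply hd
    rw [Finset.filter_eq_empty_iff.2, Finset.card_empty]
    · simp
    · rintro G - rfl
      exact hd' (hds G)

/-! ### Multigraphs with a distinguished subgraph -/

/-- The number of half-edges of `h` at `v`, where the vertex set `S` of `h` is a set in `V`. -/
def extDegree {V : Type} {S : Set V} {E : Type} (h : Multigraph S E) (v : V) : ℕ :=
  Nat.card {e : E // ((h.ends e).1 : V) = v} + Nat.card {e : E // ((h.ends e).2 : V) = v}

theorem extDegree_coe {V : Type} {S : Set V} {E : Type} (h : Multigraph S E) (v : S) :
    extDegree h v = h.degree v := by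
  simp only [extDegree, Multigraph.degree, Subtype.coe_inj]

theorem extDegree_of_notMem {V : Type} {S : Set V} {E : Type} (h : Multigraph S E) {v : V}
    (hv : v ∉ S) : extDegree h v = 0 := by
  have h1 : IsEmpty {e : E // ((h.ends e).1 : V) = v} :=
    ⟨fun e => hv (e.2 ▸ (h.ends e.1).1.2)⟩
  have h2 : IsEmpty {e : E // ((h.ends e).2 : V) = v} :=
    ⟨fun e => hv (e.2 ▸ (h.ends e.1).2.2)⟩
  simp [extDegree]

open Classical in
/-- A multigraph in which the set `T` of edges spans a subgraph with vertex set `S` consists of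
this subgraph and of the ends of the other edges. -/
def splitEquiv {V E : Type} (S : Set V) (T : Set E) :
    {G : Multigraph V E // (∀ e ∈ T, (G.ends e).1 ∈ S) ∧ ∀ e ∈ T, (G.ends e).2 ∈ S} ≃
      Multigraph S T × ({e : E // e ∉ T} → V × V) where
  toFun G := (Multigraph.Subgraph.toMultigraph ⟨S, T, G.2.1, G.2.2⟩, fun e => G.1.ends e)
  invFun p := ⟨⟨fun e => if he : e ∈ T then ((p.1.ends ⟨e, he⟩).1, (p.1.ends ⟨e, he⟩).2)
    else p.2 ⟨e, he⟩⟩, fun e he => by simp [he], fun e he => by simp [he]⟩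
  left_inv G := by
    ext e
    · by_cases he : e ∈ T <;> simp [he, Multigraph.Subgraph.toMultigraph]
    · by_cases he : e ∈ T <;> simp [he, Multigraph.Subgraph.toMultigraph]
  right_inv p := by
    refine Prod.ext ?_ ?_
    · ext e <;> simp [Multigraph.Subgraph.toMultigraph]
    · ext e : 1
      simp [e.2]

theorem natCard_split {E : Type} [Finite E] (T : Set E) (p : E → Prop) :
    Nat.card {e // p e} = Nat.card {e : T // p e} + Nat.card {e : {e // e ∉ T} // p e} := by
  classical
  rw [← Nat.card_sum]
  refine Nat.card_congr (((Equiv.sumCompl (· ∈ T)).subtypeEquiv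
    (p := fun e => p (Equiv.sumCompl (· ∈ T) e)) fun e => Iff.rfl).symm.trans
      Equiv.subtypeSum)

theorem degree_split {V E : Type} [Finite E] (S : Set V) (T : Set E)
    (G : {G : Multigraph V E // (∀ e ∈ T, (G.ends e).1 ∈ S) ∧ ∀ e ∈ T, (G.ends e).2 ∈ S}) (v : V) :
    G.1.degree v = extDegree (splitEquiv S T G).1 v +
      (Nat.card {e // ((splitEquiv S T G).2 e).1 = v} +
        Nat.card {e // ((splitEquiv S T G).2 e).2 = v}) := by
  rw [Multigraph.degree, natCard_split T, natCard_split T (fun e => (G.1.ends e).2 = v),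
    extDegree]
  simp only [splitEquiv, Multigraph.Subgraph.toMultigraph, Equiv.coe_fn_mk]
  ring

/-- The degree condition on the whole multigraph becomes, for fixed h, a condition on the ends of
the edges outside T alone. -/
theorem countDistinguished_eq_sum (𝓕 : Family) (n m : ℕ) (D : Set ℕ) :
    countDistinguished 𝓕 n m D = ∑ᶠ S : Set (Fin n), ∑ᶠ T : Set (Fin m),
      ∑ᶠ h : {h : Multigraph S T // IsFamilyGraph 𝓕 h},
        Nat.card {r : {e : Fin m // e ∉ T} → Fin n × Fin n // ∀ v, extDegree h.1 v +
          (Nat.card {e // (r e).1 = v} + Nat.card {e // (r e).2 = v}) ∈ D} := by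
  classical
  have e1 : (Σ G : DegMultigraph n m D, {H : G.1.Subgraph // IsFamilyGraph 𝓕 H.toMultigraph}) ≃
      Σ S : Set (Fin n), Σ T : Set (Fin m),
        {G : {G : Multigraph (Fin n) (Fin m) //
            (∀ e ∈ T, (G.ends e).1 ∈ S) ∧ ∀ e ∈ T, (G.ends e).2 ∈ S} //
          IsFamilyGraph 𝓕 (splitEquiv S T G).1 ∧ ∀ v, G.1.degree v ∈ D} :=
    { toFun := fun p => ⟨p.2.1.verts, p.2.1.edges, ⟨p.1.1, p.2.1.fst_mem, p.2.1.snd_mem⟩,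
        p.2.2, p.1.2⟩
      invFun := fun p => ⟨⟨p.2.2.1.1, p.2.2.2.2⟩, ⟨p.1, p.2.1, p.2.2.1.2.1, p.2.2.1.2.2⟩,
        p.2.2.2.1⟩
      left_inv := fun _ => rfl
      right_inv := fun _ => rfl }
  rw [countDistinguished, Nat.card_congr e1, Nat.card_sigma, finsum_eq_sum_of_fintype]
  refine Finset.sum_congr rfl fun S _ => ?_
  rw [Nat.card_sigma, finsum_eq_sum_of_fintype]
  refine Finset.sum_congr rfl fun T _ => ?_
  have : Fintype {h : Multigraph S T // IsFamilyGraph 𝓕 h} := Fintype.ofFinite _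
  rw [finsum_eq_sum_of_fintype, ← Nat.card_sigma]
  refine Nat.card_congr (((splitEquiv S T).subtypeEquiv
    (q := fun p => IsFamilyGraph 𝓕 p.1 ∧ ∀ v, extDegree p.1 v +
          (Nat.card {e // (p.2 e).1 = v} + Nat.card {e // (p.2 e).2 = v}) ∈ D) fun G => ?_).trans ?_)
  · simp only [degree_split S T G]
  · exact
    { toFun := fun p => ⟨⟨p.1.1, p.2.1⟩, p.1.2, p.2.2⟩
      invFun := fun p => ⟨(p.1.1, p.2.1), p.1.2, p.2.2⟩
      left_inv := fun _ => rfl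
      right_inv := fun _ => rfl }

/-- `familyPoly 𝓕 k l` at `(Δ(x), Δ'(x), …)`. -/
def familyPolyDelta (𝓕 : Family) (D : Set ℕ) (k l : ℕ) : PowerSeries ℚ :=
  MvPolynomial.aeval (fun s => deltaSeries (shift s D)) (familyPoly 𝓕 k l)

/-- A vertex outside S contributes Δ, and a vertex of degree s in h contributes Δ⁽ˢ⁾. Summed over h,
the products over S are the value of `degreePoly` at (Δ, Δ', …). -/
theorem sum_completions (𝓕 : Family) {n m : ℕ} (D : Set ℕ) (S : Set (Fin n)) (T : Set (Fin m)) :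
    ((∑ᶠ h : {h : Multigraph S T // IsFamilyGraph 𝓕 h},
        Nat.card {r : {e : Fin m // e ∉ T} → Fin n × Fin n // ∀ v, extDegree h.1 v +
          (Nat.card {e // (r e).1 = v} + Nat.card {e // (r e).2 = v}) ∈ D} : ℕ) : ℚ) =
      2 ^ T.ncard * T.ncard.factorial * S.ncard.factorial *
        (2 * (m - T.ncard)).factorial * PowerSeries.coeff (2 * (m - T.ncard))
          (familyPolyDelta 𝓕 D S.ncard T.ncard * deltaSeries D ^ (n - S.ncard)) := by
  classical
  have : Fintype {h : Multigraph S T // IsFamilyGraph 𝓕 h} := Fintype.ofFinite _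
  have hT : Nat.card {e : Fin m // e ∉ T} = m - T.ncard := by
    have h := Set.ncard_add_ncard_compl T
    rw [Nat.card_eq_fintype_card (α := Fin m), Fintype.card_fin] at h
    have h' : Nat.card {e : Fin m // e ∉ T} = Tᶜ.ncard := rfl
    omega
  have hS : Fintype.card {v : Fin n // v ∉ S} = n - S.ncard := by
    have h := Set.ncard_add_ncard_compl S
    rw [Nat.card_eq_fintype_card (α := Fin n), Fintype.card_fin] at h
    have h' : Nat.card {v : Fin n // v ∉ S} = Sᶜ.ncard := rfl
    rw [← Nat.card_eq_fintype_card]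
    omega
  have hprod : ∀ h : Multigraph S T, ∏ v, deltaSeries (shift (extDegree h v) D) =
      (∏ v, deltaSeries (shift (h.degree v) D)) * deltaSeries D ^ (n - S.ncard) := by
    intro h
    rw [← Fintype.prod_subtype_mul_prod_subtype (· ∈ S)]
    congr 1
    · exact Finset.prod_congr rfl fun v _ => by rw [extDegree_coe]
    · rw [← hS, ← Finset.card_univ, ← Finset.prod_const]
      exact Finset.prod_congr rfl fun v _ => by rw [extDegree_of_notMem h v.2, shift_zero]
  rw [finsum_eq_sum_of_fintype, Nat.cast_sum]
  simp only [card_completions, hT, hprod]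
  rw [← Finset.mul_sum, ← map_sum, ← Finset.sum_mul]
  have hQ : ∑ h : {h : Multigraph S T // IsFamilyGraph 𝓕 h},
      ∏ v, deltaSeries (shift (h.1.degree v) D) =
      MvPolynomial.aeval (fun s => deltaSeries (shift s D)) (degreePoly 𝓕 S T) := by
    rw [degreePoly, finsum_eq_sum_of_fintype, map_sum]
    refine Finset.sum_congr rfl fun h _ => ?_
    rw [map_prod]
    exact Finset.prod_congr rfl fun v _ => by rw [MvPolynomial.aeval_X]
  rw [hQ, degreePoly_congr 𝓕 (Finite.equivFin S) (Finite.equivFin T), familyPolyDelta,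
    familyPoly_eq, map_mul (MvPolynomial.aeval _), MvPolynomial.aeval_C, PowerSeries.algebraMap_apply,
    mul_assoc (PowerSeries.C _), PowerSeries.coeff_C_mul]
  -- `Nat.card S` and `S.ncard` agree by definition, and likewise for T.
  change _ * PowerSeries.coeff _ (MvPolynomial.aeval (fun s => deltaSeries (shift s D))
    (degreePoly 𝓕 (Fin S.ncard) (Fin T.ncard)) * _) = _
  have h2 : (2 : ℚ) ^ T.ncard * T.ncard.factorial * S.ncard.factorial ≠ 0 := by positivity
  simp only [Algebra.algebraMap_self, RingHom.id_apply]
  field_simp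

theorem finsum_set_ncard {α M : Type} [Fintype α] [AddCommMonoid M] (f : ℕ → M) :
    ∑ᶠ S : Set α, f S.ncard =
      ∑ k ∈ Finset.range (Fintype.card α + 1), (Fintype.card α).choose k • f k := by
  classical
  rw [← Finset.card_univ, ← Finset.sum_powerset_apply_card, finsum_eq_sum_of_fintype,
    Finset.powerset_univ]
  exact (Fintype.sum_equiv Fintype.finsetEquivSet _ _ fun S => by
    simp [Set.ncard_coe_finset]).symm

theorem countDistinguished_eq (𝓕 : Family) (n m : ℕ) (D : Set ℕ) :
    (countDistinguished 𝓕 n m D : ℚ) = ∑ k ∈ Finset.range (n + 1), ∑ l ∈ Finset.range (m + 1),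
      (n.choose k * m.choose l : ℚ) * (2 ^ l * l.factorial * k.factorial *
        (2 * (m - l)).factorial * PowerSeries.coeff (2 * (m - l))
          (familyPolyDelta 𝓕 D k l * deltaSeries D ^ (n - k))) := by
  classical
  rw [countDistinguished_eq_sum]
  simp only [finsum_eq_sum_of_fintype (α := Set (Fin _)), Nat.cast_sum, sum_completions]
  -- Back to `finsum`, the form in which `finsum_set_ncard` collects the sets of equal size.
  rw [← finsum_eq_sum_of_fintype]
  simp only [← finsum_eq_sum_of_fintype (α := Set (Fin m))]
  rw [finsum_set_ncard (fun k => ∑ᶠ T : Set (Fin m), (2 ^ T.ncard * T.ncard.factorial * k.factorial *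
        (2 * (m - T.ncard)).factorial * PowerSeries.coeff (2 * (m - T.ncard))
          (familyPolyDelta 𝓕 D k T.ncard * deltaSeries D ^ (n - k)) : ℚ)), Fintype.card_fin]
  refine Finset.sum_congr rfl fun k _ => ?_
  rw [finsum_set_ncard (fun l => (2 ^ l * l.factorial * k.factorial *
        (2 * (m - l)).factorial * PowerSeries.coeff (2 * (m - l))
          (familyPolyDelta 𝓕 D k l * deltaSeries D ^ (n - k)) : ℚ)), Fintype.card_fin,
    Finset.smul_sum]
  refine Finset.sum_congr rfl fun l _ => ?_
  simp only [nsmul_eq_mul]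
  ring

theorem countMG_eq (n m : ℕ) (D : Set ℕ) :
    (countMG n m D : ℚ) = (2 * m).factorial * PowerSeries.coeff (2 * m) (deltaSeries D ^ n) := by
  have h := card_completions (V := Fin n) (E := Fin m) (fun _ => 0) D
  simp only [zero_add, shift_zero, Finset.prod_const, Finset.card_univ, Fintype.card_fin,
    Nat.card_eq_fintype_card (α := Fin m)] at h
  rw [← h, countMG]
  congr 1
  exact Nat.card_congr
    { toFun := fun G => ⟨G.1.ends, G.2⟩
      invFun := fun r => ⟨⟨r.1⟩, r.2⟩
      left_inv := fun _ => rfl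
      right_inv := fun _ => rfl }

/-! ### The exact formula -/

theorem familySeriesDelta_coeff (𝓕 : Family) (D : Set ℕ) (k l : ℕ) :
    PowerSeries.coeff l (PowerSeries.coeff k (familySeriesDelta 𝓕 D)) =
      familyPolyDelta 𝓕 D k l := by
  simp only [familySeriesDelta, familySeries, PowerSeries.coeff_map, PowerSeries.coeff_mk,
    iterate_derivative_deltaSeries, familyPolyDelta]
  rfl

theorem expZDelta_coeff (D : Set ℕ) (i : ℕ) :
    PowerSeries.coeff i (expZDelta D) =
      PowerSeries.C (deltaSeries D ^ i * PowerSeries.C (1 / (i.factorial : ℚ))) := by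
  rw [expZDelta, PowerSeries.coeff_rescale, PowerSeries.coeff_exp, map_mul, map_pow]
  congr 1
  rw [PowerSeries.algebraMap_apply, PowerSeries.algebraMap_apply, Algebra.algebraMap_self,
    RingHom.id_apply]

/-- Here j = m − l counts the edges outside the subgraph; the factor w^j excludes j > m. -/
theorem coeff_halfEdgeSum (A : PowerSeries (PowerSeries (PowerSeries ℚ))) (n m : ℕ) :
    PowerSeries.coeff m (PowerSeries.coeff n (halfEdgeSum A)) =
      ∑ l ∈ Finset.range (m + 1), ((2 * (m - l)).factorial : ℚ) *
        PowerSeries.coeff (2 * (m - l)) (PowerSeries.coeff l (PowerSeries.coeff n A)) /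
          (2 ^ (m - l) * (m - l).factorial) := by
  simp only [halfEdgeSum, PowerSeries.coeff_mk, PowerSeries.coeff_mul_C, xCoeff,
    PowerSeries.coeff_mul_X_pow']
  rw [finsum_eq_sum_of_support_subset (s := Finset.range (m + 1))]
  · rw [← Finset.sum_range_reflect]
    refine Finset.sum_congr rfl fun l hl => ?_
    have hl' : l ≤ m := by simpa [Nat.lt_succ_iff] using hl
    have h2 : m - (m - l) = l := by omega
    simp [h2]
  · intro j hj
    by_contra hj'
    apply hj
    have : ¬ j ≤ m := by simpa [Nat.lt_succ_iff] using hj'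
    simp [this]

/-- The identity holds term by term: the binomial coefficients supply the factor 1/(n − k)! of
exp(zΔ) and the factor 1/(m − l)! of the half-edge sum, and 2^m splits as 2^l · 2^(m−l). -/
theorem countDistinguished_formula (𝓕 : Family) (D : Set ℕ) (n m : ℕ) :
    (countDistinguished 𝓕 n m D : ℚ) =
      (n.factorial : ℚ) * 2 ^ m * (m.factorial : ℚ) *
        PowerSeries.coeff m (PowerSeries.coeff n
          (halfEdgeSum (familySeriesDelta 𝓕 D * expZDelta D))) := by
  have hcoeff : ∀ l, PowerSeries.coeff l (PowerSeries.coeff n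
      (familySeriesDelta 𝓕 D * expZDelta D)) = ∑ k ∈ Finset.range (n + 1),
        familyPolyDelta 𝓕 D k l *
          (deltaSeries D ^ (n - k) * PowerSeries.C (1 / ((n - k).factorial : ℚ))) := by
    intro l
    rw [PowerSeries.coeff_mul, Finset.Nat.sum_antidiagonal_eq_sum_range_succ_mk, map_sum]
    refine Finset.sum_congr rfl fun k _ => ?_
    rw [expZDelta_coeff, PowerSeries.coeff_mul_C, familySeriesDelta_coeff]
  rw [countDistinguished_eq, coeff_halfEdgeSum, Finset.sum_comm, Finset.mul_sum]
  refine Finset.sum_congr rfl fun l hl => ?_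
  have hl' : l ≤ m := by simpa [Nat.lt_succ_iff] using hl
  rw [hcoeff, map_sum, Finset.mul_sum, Finset.sum_div, Finset.mul_sum]
  refine Finset.sum_congr rfl fun k hk => ?_
  have hk' : k ≤ n := by simpa [Nat.lt_succ_iff] using hk
  rw [← mul_assoc (familyPolyDelta 𝓕 D k l), PowerSeries.coeff_mul_C, Nat.cast_choose ℚ hk', Nat.cast_choose ℚ hl']
  have h2 : (2 : ℚ) ^ m = 2 ^ l * 2 ^ (m - l) := by rw [← pow_add]; congr 1; omega
  rw [h2]
  field_simp

/-! ### The functions `Δ`, `Δ'`, … -/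

section Entire

variable {𝕜 : Type} [RCLike 𝕜]

open Classical in
/-- The terms of the series `Δ(x)`. -/
def deltaTerm (D : Set ℕ) (x : 𝕜) (d : ℕ) : 𝕜 :=
  if d ∈ D then x ^ d / (d.factorial : 𝕜) else 0

theorem deltaTerm_of_mem {D : Set ℕ} (x : 𝕜) {d : ℕ} (h : d ∈ D) :
    deltaTerm D x d = x ^ d / (d.factorial : 𝕜) := if_pos h

theorem deltaTerm_of_notMem {D : Set ℕ} (x : 𝕜) {d : ℕ} (h : d ∉ D) :
    deltaTerm D x d = 0 := if_neg h

theorem deltaTerm_mul (D : Set ℕ) (c x : 𝕜) (d : ℕ) :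
    deltaTerm D (c * x) d = c ^ d * deltaTerm D x d := by
  by_cases h : d ∈ D
  · rw [deltaTerm_of_mem _ h, deltaTerm_of_mem _ h, mul_pow, mul_div_assoc]
  · rw [deltaTerm_of_notMem _ h, deltaTerm_of_notMem _ h, mul_zero]

theorem norm_deltaTerm (D : Set ℕ) (x : 𝕜) (d : ℕ) :
    ‖deltaTerm D x d‖ = deltaTerm D ‖x‖ d := by
  by_cases h : d ∈ D
  · rw [deltaTerm_of_mem _ h, deltaTerm_of_mem _ h, norm_div, norm_pow, RCLike.norm_natCast]
  · rw [deltaTerm_of_notMem _ h, deltaTerm_of_notMem _ h, norm_zero]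

theorem deltaTerm_nonneg (D : Set ℕ) {x : ℝ} (hx : 0 ≤ x) (d : ℕ) : 0 ≤ deltaTerm D x d := by
  by_cases h : d ∈ D
  · rw [deltaTerm_of_mem _ h]; positivity
  · rw [deltaTerm_of_notMem _ h]

theorem deltaTerm_pos {D : Set ℕ} {x : ℝ} (hx : 0 < x) {d : ℕ} (h : d ∈ D) :
    0 < deltaTerm D x d := by
  rw [deltaTerm_of_mem _ h]; positivity

theorem deltaTerm_mono (D : Set ℕ) {x y : ℝ} (hx : 0 ≤ x) (hxy : x ≤ y) (d : ℕ) :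
    deltaTerm D x d ≤ deltaTerm D y d := by
  by_cases h : d ∈ D
  · rw [deltaTerm_of_mem _ h, deltaTerm_of_mem _ h]
    gcongr
  · rw [deltaTerm_of_notMem _ h, deltaTerm_of_notMem _ h]

theorem summable_deltaTerm_real (D : Set ℕ) (x : ℝ) : Summable fun d => deltaTerm D x d := by
  refine Summable.of_norm_bounded (Real.summable_pow_div_factorial |x|) fun d => ?_
  by_cases h : d ∈ D
  · rw [deltaTerm_of_mem _ h, norm_div, norm_pow, Real.norm_eq_abs]
    simp
  · rw [deltaTerm_of_notMem _ h, norm_zero]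
    positivity

theorem summable_norm_deltaTerm (D : Set ℕ) (x : 𝕜) : Summable fun d => ‖deltaTerm D x d‖ := by
  simp only [norm_deltaTerm]
  exact summable_deltaTerm_real D ‖x‖

theorem hasSum_delta (D : Set ℕ) (x : 𝕜) : HasSum (deltaTerm D x) (Delta 𝕜 D x) :=
  (summable_norm_deltaTerm D x).of_norm.hasSum

theorem hasSum_natCast_mul_deltaTerm (D : Set ℕ) (x : 𝕜) :
    HasSum (fun d : ℕ => (d : 𝕜) * deltaTerm D x d) (x * Delta 𝕜 (shift 1 D) x) := by
  rw [← hasSum_nat_add_iff' 1]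
  simp only [Finset.range_one, Finset.sum_singleton, Nat.cast_zero, zero_mul, sub_zero]
  refine ((hasSum_delta (shift 1 D) x).mul_left x).congr_fun fun d => ?_
  by_cases h : d + 1 ∈ D
  · rw [deltaTerm_of_mem _ h, deltaTerm_of_mem _ (mem_shift.2 h), Nat.factorial_succ]
    have h1 : ((d + 1 : ℕ) : 𝕜) ≠ 0 := Nat.cast_ne_zero.2 (Nat.succ_ne_zero d)
    have h2 : (d.factorial : 𝕜) ≠ 0 := Nat.cast_ne_zero.2 (Nat.factorial_ne_zero d)
    rw [Nat.cast_mul]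
    field_simp
    ring
  · rw [deltaTerm_of_notMem _ h, deltaTerm_of_notMem _ (mt mem_shift.1 h), mul_zero, mul_zero]

theorem hasDerivAt_delta (D : Set ℕ) (x : 𝕜) :
    HasDerivAt (Delta 𝕜 D) (Delta 𝕜 (shift 1 D) x) x := by
  have hterm : ∀ (d : ℕ) (y : 𝕜), HasDerivAt (fun y : 𝕜 => deltaTerm D y (d + 1))
      (deltaTerm (shift 1 D) y d) y := by
    intro d y
    by_cases h : d + 1 ∈ D
    · simp only [deltaTerm_of_mem _ h, deltaTerm_of_mem _ (mem_shift.2 h)]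
      have h1 : ((d + 1 : ℕ) : 𝕜) ≠ 0 := Nat.cast_ne_zero.2 (Nat.succ_ne_zero d)
      have h2 : (d.factorial : 𝕜) ≠ 0 := Nat.cast_ne_zero.2 (Nat.factorial_ne_zero d)
      refine ((hasDerivAt_pow (d + 1) y).div_const ((d + 1).factorial : 𝕜)).congr_deriv ?_
      rw [Nat.factorial_succ, Nat.cast_mul, Nat.add_sub_cancel]
      field_simp
    · simp only [deltaTerm_of_notMem _ h, deltaTerm_of_notMem _ (mt mem_shift.1 h)]
      exact hasDerivAt_const y 0
  have hball : x ∈ Metric.ball (0 : 𝕜) (‖x‖ + 1) := by simp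
  -- On the ball of radius ‖x‖ + 1 the differentiated terms are dominated by the terms of Δ' at that
  -- radius. The constant term of Δ is split off so that the index d + 1 matches the shift.
  have key := hasDerivAt_tsum_of_isPreconnected
    (summable_deltaTerm_real (shift 1 D) (‖x‖ + 1)) Metric.isOpen_ball
    (convex_ball (0 : 𝕜) (‖x‖ + 1)).isPreconnected (fun d y _ => hterm d y)
    (fun d y hy => by
      rw [norm_deltaTerm]
      exact deltaTerm_mono _ (norm_nonneg y) (mem_ball_zero_iff.1 hy).le d) hball
    ((summable_nat_add_iff 1).2 (hasSum_delta D x).summable) hball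
  have hD : Delta 𝕜 D = fun y => deltaTerm D y 0 + ∑' d, deltaTerm D y (d + 1) := by
    ext y
    rw [← (hasSum_delta D y).tsum_eq, (hasSum_delta D y).summable.tsum_eq_zero_add]
  have h0 : (fun y : 𝕜 => deltaTerm D y 0) = fun _ => deltaTerm D (0 : 𝕜) 0 := by
    ext y
    by_cases h : 0 ∈ D
    · rw [deltaTerm_of_mem _ h, deltaTerm_of_mem _ h, pow_zero, pow_zero]
    · rw [deltaTerm_of_notMem _ h, deltaTerm_of_notMem _ h]
  rw [hD, ← (hasSum_delta (shift 1 D) x).tsum_eq, ← zero_add (∑' d, deltaTerm (shift 1 D) x d)]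
  refine HasDerivAt.add ?_ key
  rw [h0]
  exact hasDerivAt_const x _

theorem continuous_delta (D : Set ℕ) : Continuous (Delta 𝕜 D) :=
  continuous_iff_continuousAt.2 fun x => (hasDerivAt_delta D x).continuousAt

theorem deltaDerivs_eq (D : Set ℕ) (x : 𝕜) (s : ℕ) :
    DeltaDerivs 𝕜 D x s = Delta 𝕜 (shift s D) x := by
  have h : iteratedDeriv s (Delta 𝕜 D) = Delta 𝕜 (shift s D) := by
    induction s with
    | zero => rw [iteratedDeriv_zero, shift_zero]
    | succ s ih =>
      rw [iteratedDeriv_succ, ih]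
      ext y
      rw [(hasDerivAt_delta (shift s D) y).deriv, shift_shift]
  rw [DeltaDerivs, h]

theorem delta_ofReal (D : Set ℕ) (x : ℝ) : Delta ℂ D (x : ℂ) = (Delta ℝ D x : ℂ) := by
  refine (hasSum_delta D (x : ℂ)).unique ?_
  refine (Complex.hasSum_ofReal.2 (hasSum_delta D x)).congr_fun fun d => ?_
  by_cases h : d ∈ D
  · simp [deltaTerm_of_mem _ h]
  · simp [deltaTerm_of_notMem _ h]

theorem delta_pos {D : Set ℕ} (hD : D.Nonempty) {x : ℝ} (hx : 0 < x) : 0 < Delta ℝ D x := by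
  obtain ⟨d, hd⟩ := hD
  rw [← (hasSum_delta D x).tsum_eq]
  exact (hasSum_delta D x).summable.tsum_pos (fun d => deltaTerm_nonneg D hx.le d) d
    (deltaTerm_pos hx hd)

theorem delta_mono (D : Set ℕ) {x y : ℝ} (hx : 0 ≤ x) (hxy : x ≤ y) :
    Delta ℝ D x ≤ Delta ℝ D y :=
  hasSum_le (fun d => deltaTerm_mono D hx hxy d) (hasSum_delta D x) (hasSum_delta D y)

theorem deltaTerm_le_delta (D : Set ℕ) {x : ℝ} (hx : 0 ≤ x) (d : ℕ) :
    deltaTerm D x d ≤ Delta ℝ D x :=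
  le_hasSum (hasSum_delta D x) d fun e _ => deltaTerm_nonneg D hx e

/-! ### Values of formal power series -/

/-- The formal power series `A` converges absolutely at `x` and has the value `a` there. -/
def HasEval (A : PowerSeries ℚ) (x a : 𝕜) : Prop :=
  (Summable fun j => ‖((PowerSeries.coeff j A : ℚ) : 𝕜) * x ^ j‖) ∧
    HasSum (fun j => ((PowerSeries.coeff j A : ℚ) : 𝕜) * x ^ j) a

theorem HasEval.add {A B : PowerSeries ℚ} {x a b : 𝕜} (hA : HasEval A x a) (hB : HasEval B x b) :
    HasEval (A + B) x (a + b) := by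
  have h : ∀ j, ((PowerSeries.coeff j (A + B) : ℚ) : 𝕜) * x ^ j =
      ((PowerSeries.coeff j A : ℚ) : 𝕜) * x ^ j + ((PowerSeries.coeff j B : ℚ) : 𝕜) * x ^ j := fun j => by
    rw [map_add, Rat.cast_add, add_mul]
  refine ⟨?_, ?_⟩
  · simp only [h]
    exact Summable.of_nonneg_of_le (fun _ => norm_nonneg _) (fun _ => norm_add_le _ _)
      (hA.1.add hB.1)
  · simp only [h]
    exact hA.2.add hB.2

theorem HasEval.mul {A B : PowerSeries ℚ} {x a b : 𝕜} (hA : HasEval A x a) (hB : HasEval B x b) :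
    HasEval (A * B) x (a * b) := by
  have h : ∀ j, ((PowerSeries.coeff j (A * B) : ℚ) : 𝕜) * x ^ j =
      ∑ p ∈ Finset.HasAntidiagonal.antidiagonal j,
        ((PowerSeries.coeff p.1 A : ℚ) : 𝕜) * x ^ p.1 * (((PowerSeries.coeff p.2 B : ℚ) : 𝕜) * x ^ p.2) := by
    intro j
    rw [PowerSeries.coeff_mul, Rat.cast_sum, Finset.sum_mul]
    refine Finset.sum_congr rfl fun p hp => ?_
    rw [← Finset.HasAntidiagonal.mem_antidiagonal.1 hp, Rat.cast_mul, pow_add]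
    ring
  have hs := summable_norm_sum_mul_antidiagonal_of_summable_norm hA.1 hB.1
  refine ⟨?_, ?_⟩
  · simpa only [h] using hs
  · simp only [h]
    rw [← hA.2.tsum_eq, ← hB.2.tsum_eq,
      tsum_mul_tsum_eq_tsum_sum_antidiagonal_of_summable_norm hA.1 hB.1]
    exact hs.of_norm.hasSum

theorem hasEval_C (c : ℚ) (x : 𝕜) : HasEval (PowerSeries.C c) x (c : 𝕜) := by
  have h : ∀ j, j ≠ 0 → ((PowerSeries.coeff j (PowerSeries.C c) : ℚ) : 𝕜) * x ^ j = 0 :=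
    fun j hj => by simp [PowerSeries.coeff_C, hj]
  refine ⟨summable_of_ne_finset_zero (s := {0}) fun j hj => by
    rw [h j (by simpa using hj), norm_zero], ?_⟩
  simpa using hasSum_single 0 h

theorem HasEval.pow {A : PowerSeries ℚ} {x a : 𝕜} (hA : HasEval A x a) (n : ℕ) :
    HasEval (A ^ n) x (a ^ n) := by
  induction n with
  | zero => simpa using hasEval_C (1 : ℚ) x
  | succ n ih => rw [pow_succ, pow_succ]; exact ih.mul hA

theorem hasEval_deltaSeries (D : Set ℕ) (x : 𝕜) : HasEval (deltaSeries D) x (Delta 𝕜 D x) := by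
  have h : ∀ j, ((PowerSeries.coeff j (deltaSeries D) : ℚ) : 𝕜) * x ^ j = deltaTerm D x j := by
    intro j
    rw [deltaSeries, PowerSeries.coeff_mk, deltaTerm]
    split_ifs
    · push_cast; ring
    · simp
  refine ⟨?_, ?_⟩
  · simpa only [h] using summable_norm_deltaTerm D x
  · simpa only [h] using hasSum_delta D x

/-- The bridge between formal substitution of (Δ, Δ', …) and the analytic values in the asymptotic
part. -/
theorem hasEval_aeval (D : Set ℕ) (x : 𝕜) (p : MvPolynomial ℕ ℚ) :
    HasEval (MvPolynomial.aeval (fun s => deltaSeries (shift s D)) p) x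
      (MvPolynomial.aeval (DeltaDerivs 𝕜 D x) p) := by
  induction p using MvPolynomial.induction_on with
  | C c =>
    rw [MvPolynomial.aeval_C, MvPolynomial.aeval_C, PowerSeries.algebraMap_apply]
    simpa using hasEval_C c x
  | add p q hp hq => rw [map_add, map_add]; exact hp.add hq
  | mul_X p s hp =>
    rw [map_mul, map_mul, MvPolynomial.aeval_X, MvPolynomial.aeval_X, deltaDerivs_eq]
    exact hp.mul (hasEval_deltaSeries _ x)

theorem hasEval_familyPolyDelta (𝓕 : Family) (D : Set ℕ) (k l : ℕ) (x : 𝕜) :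
    HasEval (familyPolyDelta 𝓕 D k l) x
      (MvPolynomial.aeval (DeltaDerivs 𝕜 D x) (familyPoly 𝓕 k l)) :=
  hasEval_aeval D x _

/-- The power series with nonnegative coefficients. -/
def nonnegSeries : Subsemiring (PowerSeries ℚ) where
  carrier := {A | ∀ j, 0 ≤ PowerSeries.coeff j A}
  zero_mem' j := by simp
  one_mem' j := by rw [PowerSeries.coeff_one]; split_ifs <;> simp
  add_mem' ha hb j := by rw [map_add]; exact add_nonneg (ha j) (hb j)
  mul_mem' ha hb j := by
    rw [PowerSeries.coeff_mul]
    exact Finset.sum_nonneg fun p _ => mul_nonneg (ha p.1) (hb p.2)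

theorem deltaSeries_mem_nonnegSeries (D : Set ℕ) : deltaSeries D ∈ nonnegSeries := fun j => by
  rw [deltaSeries, PowerSeries.coeff_mk]
  split_ifs <;> positivity

/-- Nonnegativity allows the triple series to be rearranged, and to be dominated termwise by its
value at larger real arguments. -/
theorem familyPolyDelta_mem_nonnegSeries (𝓕 : Family) (D : Set ℕ) (k l : ℕ) :
    familyPolyDelta 𝓕 D k l ∈ nonnegSeries := by
  classical
  have : Fintype {G : Multigraph (Fin k) (Fin l) // IsFamilyGraph 𝓕 G} := Fintype.ofFinite _
  rw [familyPolyDelta, familyPoly_eq, map_mul, MvPolynomial.aeval_C,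
    PowerSeries.algebraMap_apply, degreePoly, finsum_eq_sum_of_fintype, map_sum]
  refine mul_mem (fun j => ?_) (sum_mem fun G _ => ?_)
  · rw [PowerSeries.coeff_C]
    split_ifs
    · simp only [Algebra.algebraMap_self, RingHom.id_apply]
      positivity
    · exact le_rfl
  · rw [map_prod]
    refine prod_mem fun v _ => ?_
    rw [MvPolynomial.aeval_X]
    exact deltaSeries_mem_nonnegSeries _

end Entire

/-! ### The saddle point -/

/-- The mean `x Δ'(x) / Δ(x)` of the Boltzmann distribution with parameter `x` on `D`. -/
def mean (D : Set ℕ) (x : ℝ) : ℝ := x * Delta ℝ (shift 1 D) x / Delta ℝ D x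

theorem mean_eq (D : Set ℕ) (x : ℝ) : x * deriv (Delta ℝ D) x / Delta ℝ D x = mean D x := by
  rw [(hasDerivAt_delta D x).deriv, mean]

theorem hasSum_sub_mul_deltaTerm (D : Set ℕ) (x t : ℝ) :
    HasSum (fun d : ℕ => ((d : ℝ) - t) * deltaTerm D x d)
      (x * Delta ℝ (shift 1 D) x - t * Delta ℝ D x) :=
  ((hasSum_natCast_mul_deltaTerm D x).sub ((hasSum_delta D x).mul_left t)).congr_fun
    fun d => by rw [sub_mul]

theorem lt_mean_iff {D : Set ℕ} (hD : D.Nonempty) {x : ℝ} (hx : 0 < x) (t : ℝ) :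
    t < mean D x ↔ 0 < x * Delta ℝ (shift 1 D) x - t * Delta ℝ D x := by
  rw [mean, lt_div_iff₀ (delta_pos hD hx), sub_pos]

theorem mean_lt_iff {D : Set ℕ} (hD : D.Nonempty) {x : ℝ} (hx : 0 < x) (t : ℝ) :
    mean D x < t ↔ x * Delta ℝ (shift 1 D) x - t * Delta ℝ D x < 0 := by
  rw [mean, div_lt_iff₀ (delta_pos hD hx), sub_neg]

theorem mean_mul_delta {D : Set ℕ} (hD : D.Nonempty) {x : ℝ} (hx : 0 < x) :
    x * Delta ℝ (shift 1 D) x - mean D x * Delta ℝ D x = 0 := by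
  rw [mean, div_mul_cancel₀ _ (delta_pos hD hx).ne', sub_self]

/-- With t the mean at x, the sum of (d − t) x^d / d! over D is 0. Passing to y multiplies the terms
by (y/x)^d, and (y/x)^d − (y/x)^t has the sign of d − t, so the sum becomes positive. The powers are
real because t need not be an integer. -/
theorem mean_strictMonoOn {D : Set ℕ} (hD : D.Nontrivial) :
    StrictMonoOn (mean D) (Set.Ioi 0) := by
  intro x hx y hy hxy
  rw [Set.mem_Ioi] at hx hy
  rw [lt_mean_iff hD.nonempty hy]
  set t := mean D x with ht
  have hq : 1 < y / x := (one_lt_div hx).2 hxy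
  have hq0 : 0 < y / x := by positivity
  have h0 := (hasSum_sub_mul_deltaTerm D x t).mul_left ((y / x) ^ t)
  rw [ht, mean_mul_delta hD.nonempty hx, mul_zero, ← ht] at h0
  have h1 := hasSum_sub_mul_deltaTerm D y t
  have hy' : ∀ d, deltaTerm D y d = (y / x) ^ (d : ℝ) * deltaTerm D x d := fun d => by
    rw [Real.rpow_natCast, ← deltaTerm_mul, div_mul_cancel₀ _ hx.ne']
  have hdiff : ∀ d : ℕ, ((d : ℝ) - t) * deltaTerm D y d -
      (y / x) ^ t * (((d : ℝ) - t) * deltaTerm D x d) =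
      (((d : ℝ) - t) * ((y / x) ^ (d : ℝ) - (y / x) ^ t)) * deltaTerm D x d := fun d => by
    rw [hy']; ring
  have hpos : ∀ d : ℕ, (d : ℝ) ≠ t → 0 < ((d : ℝ) - t) * ((y / x) ^ (d : ℝ) - (y / x) ^ t) := by
    intro d hd
    rcases lt_or_gt_of_ne hd with h | h
    · exact mul_pos_of_neg_of_neg (sub_neg.2 h)
        (sub_neg.2 ((Real.rpow_lt_rpow_left_iff hq).2 h))
    · exact mul_pos (sub_pos.2 h) (sub_pos.2 ((Real.rpow_lt_rpow_left_iff hq).2 h))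
  obtain ⟨d, hd, hdt⟩ : ∃ d ∈ D, (d : ℝ) ≠ t := by
    obtain ⟨a, ha, b, hb, hab⟩ := hD
    by_cases h : (a : ℝ) = t
    · exact ⟨b, hb, fun h' => hab (by exact_mod_cast h.trans h'.symm)⟩
    · exact ⟨a, ha, h⟩
  refine hasSum_lt (i := d) (fun e => ?_) ?_ h0 h1
  · rw [← sub_nonneg, hdiff]
    rcases eq_or_ne (e : ℝ) t with h | h
    · rw [h, sub_self, zero_mul, zero_mul]
    · exact mul_nonneg (hpos e h).le (deltaTerm_nonneg D hx.le e)
  · rw [← sub_pos, hdiff]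
    exact mul_pos (hpos d hdt) (deltaTerm_pos hx hd)

/-- For small x the least element d₀ dominates: in the sum of (d − d₀) x^d / d! the term d₀
vanishes, so the sum is O(x^(d₀+1)), whereas (t − d₀) Δ(x) is at least of order x^d₀. -/
theorem exists_mean_lt {D : Set ℕ} (hD : D.Nonempty) {t : ℝ} (ht : ((sInf D : ℕ) : ℝ) < t) :
    ∃ x, 0 < x ∧ mean D x < t := by
  set d₀ := sInf D with hd₀
  have hmem : d₀ ∈ D := Nat.sInf_mem hD
  obtain ⟨M, hM⟩ : ∃ M, HasSum (fun d : ℕ => ((d : ℝ) - d₀) * deltaTerm D 1 d) M :=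
    ⟨_, hasSum_sub_mul_deltaTerm D 1 d₀⟩
  have hc : 0 < (t - d₀) / (d₀.factorial : ℝ) := div_pos (sub_pos.2 ht) (by positivity)
  have hM0 : 0 ≤ M := hM.nonneg fun d => by
    by_cases hd : d ∈ D
    · exact mul_nonneg (sub_nonneg.2 (Nat.cast_le.2 (Nat.sInf_le hd)))
        (deltaTerm_nonneg D zero_le_one d)
    · rw [deltaTerm_of_notMem _ hd, mul_zero]
  set x : ℝ := min 1 ((t - d₀) / (d₀.factorial : ℝ) / (M + 1)) with hx
  have hx0 : 0 < x := lt_min one_pos (by positivity)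
  have hx1 : x ≤ 1 := min_le_left _ _
  have hxM : x * M < (t - d₀) / (d₀.factorial : ℝ) := by
    have : x * (M + 1) ≤ (t - d₀) / (d₀.factorial : ℝ) := by
      rw [← le_div_iff₀ (by positivity)]; exact min_le_right _ _
    nlinarith
  refine ⟨x, hx0, ?_⟩
  rw [mean_lt_iff hD hx0]
  have h1 : x * Delta ℝ (shift 1 D) x - d₀ * Delta ℝ D x ≤ x ^ (d₀ + 1) * M := by
    refine hasSum_le (fun d => ?_) (hasSum_sub_mul_deltaTerm D x d₀) (hM.mul_left _)
    by_cases hd : d ∈ D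
    · rcases (Nat.sInf_le hd).eq_or_lt with h | h
      · rw [← hd₀] at h; simp [h]
      · rw [deltaTerm_of_mem _ hd, deltaTerm_of_mem _ hd, one_pow]
        have h2 : x ^ d ≤ x ^ (d₀ + 1) := pow_le_pow_of_le_one hx0.le hx1 h
        have h3 : (0 : ℝ) ≤ (d : ℝ) - d₀ := sub_nonneg.2 (Nat.cast_le.2 (Nat.sInf_le hd))
        calc ((d : ℝ) - d₀) * (x ^ d / d.factorial)
            ≤ ((d : ℝ) - d₀) * (x ^ (d₀ + 1) / d.factorial) := by gcongr
          _ = _ := by ring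
    · rw [deltaTerm_of_notMem _ hd, deltaTerm_of_notMem _ hd, mul_zero, mul_zero]
  have h2 := deltaTerm_le_delta D hx0.le d₀
  rw [deltaTerm_of_mem _ hmem] at h2
  have h3 : x ^ (d₀ + 1) * M < (t - d₀) * (x ^ d₀ / d₀.factorial) := by
    calc x ^ (d₀ + 1) * M = x ^ d₀ * (x * M) := by ring
      _ < x ^ d₀ * ((t - d₀) / (d₀.factorial : ℝ)) := by gcongr
      _ = _ := by ring
  have h4 : (t - d₀) * (x ^ d₀ / d₀.factorial) ≤ (t - d₀) * Delta ℝ D x :=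
    mul_le_mul_of_nonneg_left h2 (sub_pos.2 ht).le
  linarith

/-- For large x, elements of D below d₁ contribute only O(x^(d₁−1)) to the deficit of the mean below
d₁, whereas (d₁ − t) Δ(x) is at least of order x^d₁; larger elements only help. -/
theorem exists_lt_mean {D : Set ℕ} {t : ℝ} {d₁ : ℕ} (hd₁ : d₁ ∈ D) (ht : t < d₁) :
    ∃ x, 0 < x ∧ t < mean D x := by
  have hD : D.Nonempty := ⟨d₁, hd₁⟩
  obtain ⟨M, hM⟩ : ∃ M, HasSum (fun d : ℕ => |((d : ℝ) - d₁) * deltaTerm D 1 d|) M :=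
    (hasSum_sub_mul_deltaTerm D 1 d₁).summable.abs
  have hc : 0 < (d₁ - t) / (d₁.factorial : ℝ) := div_pos (sub_pos.2 ht) (by positivity)
  have hM0 : 0 ≤ M := hM.nonneg fun d => abs_nonneg _
  set x : ℝ := max 1 ((M + 1) / ((d₁ - t) / (d₁.factorial : ℝ))) with hx
  have hx1 : 1 ≤ x := le_max_left _ _
  have hx0 : 0 < x := one_pos.trans_le hx1
  have hxM : M < x * ((d₁ - t) / (d₁.factorial : ℝ)) := by
    have : M + 1 ≤ x * ((d₁ - t) / (d₁.factorial : ℝ)) := by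
      rw [← div_le_iff₀ hc]; exact le_max_right _ _
    linarith
  refine ⟨x, hx0, ?_⟩
  rw [lt_mean_iff hD hx0]
  have h1 : x * Delta ℝ (shift 1 D) x - d₁ * Delta ℝ D x ≥ -(x ^ d₁ / x * M) := by
    rw [ge_iff_le, neg_mul_eq_mul_neg]
    refine hasSum_le (fun d => ?_) (hM.neg.mul_left _) (hasSum_sub_mul_deltaTerm D x d₁)
    by_cases hd : d ∈ D
    · rw [deltaTerm_of_mem _ hd, deltaTerm_of_mem _ hd, one_pow]
      rcases le_or_gt d₁ d with h | h
      · have h3 : (0 : ℝ) ≤ (d : ℝ) - d₁ := sub_nonneg.2 (Nat.cast_le.2 h)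
        have h4 : 0 ≤ x ^ d₁ / x * |((d : ℝ) - d₁) * (1 / d.factorial)| := by positivity
        have h5 : 0 ≤ ((d : ℝ) - d₁) * (x ^ d / d.factorial) := by positivity
        linarith
      · have h3 : (d : ℝ) - d₁ ≤ 0 := sub_nonpos.2 (Nat.cast_le.2 h.le)
        rw [abs_mul, abs_of_nonpos h3, abs_of_nonneg (by positivity)]
        have h2 : x ^ d ≤ x ^ d₁ / x := by
          rw [le_div_iff₀ hx0, ← pow_succ]
          exact pow_le_pow_right₀ hx1 h
        calc x ^ d₁ / x * -(-((d : ℝ) - d₁) * (1 / d.factorial))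
            = ((d : ℝ) - d₁) * (x ^ d₁ / x / d.factorial) := by ring
          _ ≤ ((d : ℝ) - d₁) * (x ^ d / d.factorial) :=
            mul_le_mul_of_nonpos_left (by gcongr) h3
    · rw [deltaTerm_of_notMem _ hd, deltaTerm_of_notMem _ hd]
      simp
  have h2 := deltaTerm_le_delta D hx0.le d₁
  rw [deltaTerm_of_mem _ hd₁] at h2
  have h3 : x ^ d₁ / x * M < (d₁ - t) * (x ^ d₁ / d₁.factorial) := by
    calc x ^ d₁ / x * M < x ^ d₁ / x * (x * ((d₁ - t) / (d₁.factorial : ℝ))) := by gcongr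
      _ = _ := by field_simp
  have h4 : (d₁ - t) * (x ^ d₁ / d₁.factorial) ≤ (d₁ - t) * Delta ℝ D x :=
    mul_le_mul_of_nonneg_left h2 (sub_pos.2 ht).le
  linarith

theorem continuousOn_mean {D : Set ℕ} (hD : D.Nonempty) : ContinuousOn (mean D) (Set.Ioi 0) :=
  ((continuous_id.mul (continuous_delta _)).continuousOn).div (continuous_delta _).continuousOn
    fun _ hx => (delta_pos hD hx).ne'

theorem chi_spec {D : Set ℕ} {t : ℝ} (ht : ((sInf D : ℕ) : ℝ) < t)
    (ht' : ∃ d ∈ D, t < (d : ℝ)) : 0 < chi D t ∧ mean D (chi D t) = t := by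
  obtain ⟨d, hd, htd⟩ := ht'
  have hD : D.Nonempty := ⟨d, hd⟩
  obtain ⟨a, ha, hat⟩ := exists_mean_lt hD ht
  obtain ⟨b, hb, hbt⟩ := exists_lt_mean hd htd
  have hex : ∃ x, 0 < x ∧ x * deriv (Delta ℝ D) x / Delta ℝ D x = t := by
    simp only [mean_eq]
    obtain ⟨x, hx, hxt⟩ := isPreconnected_Ioi.intermediate_value (Set.mem_Ioi.2 ha)
      (Set.mem_Ioi.2 hb) (continuousOn_mean hD) ⟨hat.le, hbt.le⟩
    exact ⟨x, hx, hxt⟩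
  have h := Classical.epsilon_spec hex
  rw [mean_eq] at h
  exact h

theorem eventually_mem_range {D : Set ℕ} {lam : ℝ} {t : ℕ → ℝ} (ht : Tendsto t atTop (𝓝 lam))
    (h₁ : ((sInf D : ℕ) : ℝ) < lam) (h₂ : ∃ d ∈ D, lam < (d : ℝ)) :
    ∀ᶠ n in atTop, ((sInf D : ℕ) : ℝ) < t n ∧ ∃ d ∈ D, t n < (d : ℝ) := by
  obtain ⟨d, hd, hlam⟩ := h₂
  filter_upwards [ht.eventually (lt_mem_nhds h₁), ht.eventually (gt_mem_nhds hlam)] with n h h'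
  exact ⟨h, d, hd, h'⟩

theorem tendsto_chi {D : Set ℕ} (hD : D.Nontrivial) {lam : ℝ} {t : ℕ → ℝ}
    (ht : Tendsto t atTop (𝓝 lam)) (h₁ : ((sInf D : ℕ) : ℝ) < lam)
    (h₂ : ∃ d ∈ D, lam < (d : ℝ)) :
    Tendsto (fun n => chi D (t n)) atTop (𝓝 (chi D lam)) := by
  obtain ⟨h0, hlam⟩ := chi_spec h₁ h₂
  have hmono := mean_strictMonoOn hD
  rw [tendsto_order]
  refine ⟨fun a ha => ?_, fun b hb => ?_⟩
  · have ha' : max a (chi D lam / 2) < chi D lam := max_lt ha (half_lt_self h0)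
    have ha0 : 0 < max a (chi D lam / 2) := (half_pos h0).trans_le (le_max_right _ _)
    have h := hmono ha0 h0 ha'
    rw [hlam] at h
    filter_upwards [eventually_mem_range ht h₁ h₂, ht.eventually (lt_mem_nhds h)] with n hn hn'
    obtain ⟨hc, hc'⟩ := chi_spec hn.1 hn.2
    rw [← hc'] at hn'
    exact (le_max_left _ _).trans_lt ((hmono.lt_iff_lt ha0 hc).1 hn')
  · have hb0 : 0 < b := h0.trans hb
    have h := hmono h0 hb0 hb
    rw [hlam] at h
    filter_upwards [eventually_mem_range ht h₁ h₂, ht.eventually (gt_mem_nhds h)] with n hn hn'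
    obtain ⟨hc, hc'⟩ := chi_spec hn.1 hn.2
    rw [← hc'] at hn'
    exact (hmono.lt_iff_lt hc hb0).1 hn'

/-! ### Fourier inversion for power series coefficients -/

theorem integral_exp_int_mul (k : ℤ) :
    ∫ θ in (-Real.pi)..Real.pi, Complex.exp (k * Complex.I * (θ : ℂ)) =
      if k = 0 then 2 * (Real.pi : ℂ) else 0 := by
  split_ifs with hk
  · simp [hk]; ring
  · have hc : (k : ℂ) * Complex.I ≠ 0 := mul_ne_zero (Int.cast_ne_zero.2 hk) Complex.I_ne_zero
    rw [integral_exp_mul_complex hc]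
    have h : Complex.exp (k * Complex.I * (Real.pi : ℂ)) =
        Complex.exp (k * Complex.I * ((-Real.pi : ℝ) : ℂ)) := by
      rw [← mul_one (Complex.exp (k * Complex.I * ((-Real.pi : ℝ) : ℂ))),
        ← Complex.exp_int_mul_two_pi_mul_I k, ← Complex.exp_add]
      congr 1
      push_cast
      ring
    rw [h, sub_self, zero_div]

theorem norm_exp_ofReal_mul_I_mul (x y : ℝ) :
    ‖Complex.exp ((x : ℂ) * y * Complex.I)‖ = 1 := by
  rw [← Complex.ofReal_mul, Complex.norm_exp_ofReal_mul_I]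

/-- The norms of the terms do not depend on θ, so absolute convergence permits termwise integration,
and orthogonality leaves the index j. -/
theorem integral_eval_mul_exp {A : PowerSeries ℚ} {x : ℝ} {f : ℝ → ℂ}
    (hA : ∀ θ : ℝ, HasEval A ((x : ℂ) * Complex.exp (θ * Complex.I)) (f θ)) (j : ℕ) :
    ∫ θ in (-Real.pi)..Real.pi, f θ * Complex.exp (-((j : ℂ) * Complex.I * θ)) =
      2 * (Real.pi : ℂ) * (((PowerSeries.coeff j A : ℚ) : ℂ) * (x : ℂ) ^ j) := by
  let g : ℕ → C(ℝ, ℂ) := fun i => ⟨fun θ => ((PowerSeries.coeff i A : ℚ) : ℂ) * (x : ℂ) ^ i *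
    Complex.exp (((i : ℤ) - (j : ℤ) : ℤ) * Complex.I * (θ : ℂ)), by fun_prop⟩
  have hg : ∀ (i : ℕ) (θ : ℝ), g i θ = ((PowerSeries.coeff i A : ℚ) : ℂ) *
      ((x : ℂ) * Complex.exp (θ * Complex.I)) ^ i * Complex.exp (-((j : ℂ) * Complex.I * θ)) := by
    intro i θ
    change ((PowerSeries.coeff i A : ℚ) : ℂ) * (x : ℂ) ^ i *
      Complex.exp (((i : ℤ) - (j : ℤ) : ℤ) * Complex.I * (θ : ℂ)) = _
    have h1 : Complex.exp (((i : ℤ) - (j : ℤ) : ℤ) * Complex.I * (θ : ℂ)) =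
        Complex.exp ((i : ℂ) * (θ * Complex.I)) * Complex.exp (-((j : ℂ) * Complex.I * θ)) := by
      rw [← Complex.exp_add]
      congr 1
      push_cast
      ring
    rw [mul_pow, ← Complex.exp_nat_mul, h1]
    ring
  have hnorm : ∀ (i : ℕ) (θ : ℝ),
      ‖g i θ‖ = ‖((PowerSeries.coeff i A : ℚ) : ℂ) * (x : ℂ) ^ i‖ := by
    intro i θ
    change ‖((PowerSeries.coeff i A : ℚ) : ℂ) * (x : ℂ) ^ i *
      Complex.exp (((i : ℤ) - (j : ℤ) : ℤ) * Complex.I * (θ : ℂ))‖ = _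
    rw [norm_mul]
    have h1 : (((i : ℤ) - (j : ℤ) : ℤ) : ℂ) * Complex.I * (θ : ℂ) =
        ((((i : ℤ) - (j : ℤ) : ℤ) * θ : ℝ) : ℂ) * Complex.I := by push_cast; ring
    rw [h1, Complex.norm_exp_ofReal_mul_I, mul_one]
  have hsum : Summable fun i => ‖((PowerSeries.coeff i A : ℚ) : ℂ) * (x : ℂ) ^ i‖ := by
    simpa using (hA 0).1
  have h := intervalIntegral.hasSum_intervalIntegral_of_summable_norm (a := -Real.pi)
    (b := Real.pi) (f := g) (Summable.of_nonneg_of_le (fun _ => norm_nonneg _)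
      (fun i => (ContinuousMap.norm_le _ (norm_nonneg _)).2 fun θ => (hnorm i θ).le) hsum)
  have h1 : ∀ θ : ℝ, ∑' i, g i θ = f θ * Complex.exp (-((j : ℂ) * Complex.I * θ)) := by
    intro θ
    simp only [hg]
    rw [tsum_mul_right, (hA θ).2.tsum_eq]
  simp only [h1] at h
  refine h.unique ?_
  have h2 : ∀ i, ∫ θ in (-Real.pi)..Real.pi, g i θ =
      if i = j then 2 * (Real.pi : ℂ) * (((PowerSeries.coeff j A : ℚ) : ℂ) * (x : ℂ) ^ j)
        else 0 := by
    intro i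
    change ∫ θ in (-Real.pi)..Real.pi, ((PowerSeries.coeff i A : ℚ) : ℂ) * (x : ℂ) ^ i *
      Complex.exp (((i : ℤ) - (j : ℤ) : ℤ) * Complex.I * (θ : ℂ)) = _
    rw [intervalIntegral.integral_const_mul, integral_exp_int_mul]
    by_cases hij : i = j
    · subst hij
      simp
      ring
    · have : (i : ℤ) - j ≠ 0 := by omega
      rw [if_neg this, if_neg hij, mul_zero]
  simp only [h2]
  convert hasSum_ite_eq j (2 * (Real.pi : ℂ) * (((PowerSeries.coeff j A : ℚ) : ℂ) * (x : ℂ) ^ j))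

/-! ### The Boltzmann distribution on `D` -/

/-- The probability that `N` independent variables with the Boltzmann distribution with
parameter `x` on `D` have the sum `j`. -/
def sumProb (D : Set ℕ) (N : ℕ) (x : ℝ) (j : ℕ) : ℝ :=
  ((PowerSeries.coeff j (deltaSeries D ^ N) : ℚ) : ℝ) * x ^ j / Delta ℝ D x ^ N

/-- The characteristic function of the Boltzmann distribution. -/
def charFn (D : Set ℕ) (x θ : ℝ) : ℂ :=
  Delta ℂ D ((x : ℂ) * Complex.exp (θ * Complex.I)) / (Delta ℝ D x : ℂ)

theorem continuous_charFn (D : Set ℕ) (x : ℝ) : Continuous (charFn D x) :=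
  ((continuous_delta D).comp (by fun_prop)).div_const _

theorem sumProb_eq_integral (D : Set ℕ) (N : ℕ) (x : ℝ) (j : ℕ) :
    (sumProb D N x j : ℂ) = (2 * (Real.pi : ℂ))⁻¹ * ∫ θ in (-Real.pi)..Real.pi,
      charFn D x θ ^ N * Complex.exp (-((j : ℂ) * Complex.I * θ)) := by
  have h := integral_eval_mul_exp (A := deltaSeries D ^ N) (x := x)
    (f := fun θ => Delta ℂ D ((x : ℂ) * Complex.exp (θ * Complex.I)) ^ N)
    (fun θ => (hasEval_deltaSeries D _).pow N) j
  have h1 : ∀ θ : ℝ, charFn D x θ ^ N * Complex.exp (-((j : ℂ) * Complex.I * θ)) =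
      ((Delta ℝ D x : ℂ) ^ N)⁻¹ * (Delta ℂ D ((x : ℂ) * Complex.exp (θ * Complex.I)) ^ N *
        Complex.exp (-((j : ℂ) * Complex.I * θ))) := fun θ => by
    rw [charFn, div_pow]; ring
  simp only [h1]
  rw [intervalIntegral.integral_const_mul, h, sumProb]
  have hpi : (Real.pi : ℂ) ≠ 0 := Complex.ofReal_ne_zero.2 Real.pi_ne_zero
  push_cast
  field_simp

theorem sumProb_nonneg {D : Set ℕ} {x : ℝ} (hx : 0 ≤ x) (N j : ℕ) : 0 ≤ sumProb D N x j := by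
  have h1 : (0 : ℚ) ≤ PowerSeries.coeff j (deltaSeries D ^ N) :=
    pow_mem (deltaSeries_mem_nonnegSeries D) N j
  have h2 : 0 ≤ Delta ℝ D x := (hasSum_delta D x).nonneg fun d => deltaTerm_nonneg D hx d
  have h3 : (0 : ℝ) ≤ ((PowerSeries.coeff j (deltaSeries D ^ N) : ℚ) : ℝ) := by exact_mod_cast h1
  unfold sumProb
  positivity

theorem deltaTerm_ofReal (D : Set ℕ) (x : ℝ) (d : ℕ) :
    deltaTerm D (x : ℂ) d = ((deltaTerm D x d : ℝ) : ℂ) := by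
  by_cases h : d ∈ D
  · simp [deltaTerm_of_mem _ h]
  · simp [deltaTerm_of_notMem _ h]

theorem deltaTerm_mul_exp (D : Set ℕ) (x θ : ℝ) (d : ℕ) :
    deltaTerm D ((x : ℂ) * Complex.exp (θ * Complex.I)) d =
      ((deltaTerm D x d : ℝ) : ℂ) * Complex.exp ((θ : ℂ) * (d : ℝ) * Complex.I) := by
  rw [mul_comm (x : ℂ), deltaTerm_mul, deltaTerm_ofReal, ← Complex.exp_nat_mul, mul_comm]
  congr 2
  push_cast
  ring

/-! ### Decay of the characteristic function, uniformly in the parameter -/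

theorem norm_one_sub_sq {u : ℂ} (hu : ‖u‖ = 1) : ‖1 - u‖ ^ 2 = 2 * (1 - u.re) := by
  have h1 := Complex.sq_norm (1 - u)
  have h2 := Complex.sq_norm u
  rw [hu, Complex.normSq_apply] at h2
  rw [h1, Complex.normSq_apply]
  simp only [Complex.sub_re, Complex.one_re, Complex.sub_im, Complex.one_im]
  linarith

theorem exists_unit_mul_eq_norm (z : ℂ) : ∃ ω : ℂ, ‖ω‖ = 1 ∧ ω * z = ‖z‖ := by
  rcases eq_or_ne z 0 with rfl | hz
  · exact ⟨1, by simp, by simp⟩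
  · have h : (‖z‖ : ℂ) ≠ 0 := Complex.ofReal_ne_zero.2 (norm_ne_zero_iff.2 hz)
    exact ⟨(‖z‖ : ℂ) / z, by simp [norm_ne_zero_iff.2 hz], by field_simp⟩

/-- Rotating Δ(x e^{iθ}) by ω onto the positive axis gives 2(Δ(x) − |Δ(x e^{iθ})|) = ∑ x^d/d! · |1 −
ω e^{iθd}|² over D. Each nonnegative term is at most the sum. -/
theorem exists_unit_deltaTerm_mul_le (D : Set ℕ) {x : ℝ} (hx : 0 ≤ x) (θ : ℝ) :
    ∃ ω : ℂ, ‖ω‖ = 1 ∧ ∀ d, deltaTerm D x d *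
      ‖1 - ω * Complex.exp ((θ : ℂ) * (d : ℝ) * Complex.I)‖ ^ 2 ≤
        2 * (Delta ℝ D x - ‖Delta ℂ D ((x : ℂ) * Complex.exp (θ * Complex.I))‖) := by
  obtain ⟨ω, hω, hωz⟩ :=
    exists_unit_mul_eq_norm (Delta ℂ D ((x : ℂ) * Complex.exp (θ * Complex.I)))
  refine ⟨ω, hω, fun d => ?_⟩
  have h1 := Complex.hasSum_re
    ((hasSum_delta D ((x : ℂ) * Complex.exp (θ * Complex.I))).mul_left ω)
  rw [hωz, Complex.ofReal_re] at h1
  have hterm : ∀ d : ℕ, deltaTerm D x d *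
      ‖1 - ω * Complex.exp ((θ : ℂ) * (d : ℝ) * Complex.I)‖ ^ 2 = 2 * (deltaTerm D x d -
        (ω * deltaTerm D ((x : ℂ) * Complex.exp (θ * Complex.I)) d).re) := by
    intro d
    have h2 : (ω * (((deltaTerm D x d : ℝ) : ℂ) * Complex.exp ((θ : ℂ) * (d : ℝ) * Complex.I))).re =
        deltaTerm D x d * (ω * Complex.exp ((θ : ℂ) * (d : ℝ) * Complex.I)).re := by
      rw [← Complex.re_ofReal_mul]
      congr 1
      ring
    rw [norm_one_sub_sq (by rw [norm_mul, hω, norm_exp_ofReal_mul_I_mul, mul_one]),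
      deltaTerm_mul_exp, h2]
    ring
  have h3 := ((hasSum_delta D x).sub h1).mul_left 2
  rw [hterm]
  refine le_hasSum h3 d fun e _ => ?_
  rw [← hterm]
  exact mul_nonneg (deltaTerm_nonneg D hx e) (by positivity)

/-- The integers `k` for which `1 - e ^ {i k θ}` controls the decay of `|Δ(x e ^ {i θ})|`, with
a constant that is uniform over `x ∈ [a, b]`. -/
def decayInts (D : Set ℕ) (a b : ℝ) : AddSubgroup ℤ where
  carrier := {k | ∃ C : ℝ, 0 ≤ C ∧ ∀ x, a ≤ x → x ≤ b → ∀ θ : ℝ,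
    ‖1 - Complex.exp ((θ : ℂ) * (k : ℝ) * Complex.I)‖ ^ 2 ≤
      C * |Delta ℝ D x - ‖Delta ℂ D ((x : ℂ) * Complex.exp (θ * Complex.I))‖|}
  zero_mem' := ⟨0, le_rfl, fun x _ _ θ => by simp⟩
  add_mem' := by
    rintro k k' ⟨C, hC, h⟩ ⟨C', hC', h'⟩
    refine ⟨2 * C + 2 * C', by positivity, fun x hax hxb θ => ?_⟩
    have h1 := h x hax hxb θ
    have h2 := h' x hax hxb θ
    set u := Complex.exp ((θ : ℂ) * (k : ℝ) * Complex.I) with hu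
    set v := Complex.exp ((θ : ℂ) * (k' : ℝ) * Complex.I) with hv
    have h3 : Complex.exp ((θ : ℂ) * ((k + k' : ℤ) : ℝ) * Complex.I) = u * v := by
      rw [hu, hv, ← Complex.exp_add]
      congr 1
      push_cast
      ring
    have h4 : ‖1 - u * v‖ ≤ ‖1 - u‖ + ‖1 - v‖ := by
      have h5 : 1 - u * v = (1 - u) + u * (1 - v) := by ring
      have h6 : ‖u‖ = 1 := norm_exp_ofReal_mul_I_mul θ k
      calc ‖1 - u * v‖ ≤ ‖1 - u‖ + ‖u * (1 - v)‖ := by rw [h5]; exact norm_add_le _ _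
        _ = _ := by rw [norm_mul, h6, one_mul]
    rw [h3]
    nlinarith [norm_nonneg (1 - u * v), norm_nonneg (1 - u), norm_nonneg (1 - v),
      sq_nonneg (‖1 - u‖ - ‖1 - v‖)]
  neg_mem' := by
    rintro k ⟨C, hC, h⟩
    refine ⟨C, hC, fun x hax hxb θ => ?_⟩
    have h1 := h x hax hxb θ
    set u := Complex.exp ((θ : ℂ) * (k : ℝ) * Complex.I) with hu
    have h3 : Complex.exp ((θ : ℂ) * ((-k : ℤ) : ℝ) * Complex.I) = u⁻¹ := by
      rw [hu, ← Complex.exp_neg]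
      congr 1
      push_cast
      ring
    have h6 : ‖u‖ = 1 := norm_exp_ofReal_mul_I_mul θ k
    have h7 : u ≠ 0 := Complex.exp_ne_zero _
    have h4 : ‖1 - u⁻¹‖ = ‖1 - u‖ := by
      have h5 : 1 - u⁻¹ = -(u⁻¹ * (1 - u)) := by field_simp; ring
      rw [h5, norm_neg, norm_mul, norm_inv, h6, inv_one, one_mul]
    rw [h3, h4]
    exact h1

/-- The unknown ω cancels between d and e, since |1 − e^{iθ(d−e)}| is the modulus of (1 − ω e^{iθd})
− (1 − ω e^{iθe}). Bounding the weights below by those at a makes the constant uniform. -/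
theorem sub_mem_decayInts {D : Set ℕ} {a b : ℝ} (ha : 0 < a) {d e : ℕ} (hd : d ∈ D)
    (he : e ∈ D) : (d : ℤ) - e ∈ decayInts D a b := by
  have hda := deltaTerm_pos ha hd
  have hea := deltaTerm_pos ha he
  refine ⟨4 / deltaTerm D a d + 4 / deltaTerm D a e, by positivity, fun x hax hxb θ => ?_⟩
  obtain ⟨ω, hω, h⟩ := exists_unit_deltaTerm_mul_le D (ha.le.trans hax) θ
  set R := Delta ℝ D x - ‖Delta ℂ D ((x : ℂ) * Complex.exp (θ * Complex.I))‖ with hR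
  have key : ∀ {f : ℕ}, f ∈ D →
      ‖1 - ω * Complex.exp ((θ : ℂ) * (f : ℝ) * Complex.I)‖ ^ 2 ≤ 2 / deltaTerm D a f * |R| := by
    intro f hf
    have hfa := deltaTerm_pos ha hf
    rw [div_mul_eq_mul_div, le_div_iff₀ hfa, mul_comm]
    calc _ ≤ deltaTerm D x f * ‖1 - ω * Complex.exp ((θ : ℂ) * (f : ℝ) * Complex.I)‖ ^ 2 := by
          gcongr
          exact deltaTerm_mono D ha.le hax f
      _ ≤ 2 * R := h f
      _ ≤ 2 * |R| := by gcongr; exact le_abs_self R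
  have h1 := key hd
  have h2 := key he
  set u := Complex.exp ((θ : ℂ) * (d : ℝ) * Complex.I) with hu
  set v := Complex.exp ((θ : ℂ) * (e : ℝ) * Complex.I) with hv
  have h3 : Complex.exp ((θ : ℂ) * (((d : ℤ) - e : ℤ) : ℝ) * Complex.I) * v = u := by
    rw [hu, hv, ← Complex.exp_add]
    congr 1
    push_cast
    ring
  set w := Complex.exp ((θ : ℂ) * (((d : ℤ) - e : ℤ) : ℝ) * Complex.I) with hw
  have hvn : ‖v‖ = 1 := norm_exp_ofReal_mul_I_mul θ e
  have h4 : ‖1 - w‖ ≤ ‖1 - ω * u‖ + ‖1 - ω * v‖ := by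
    calc ‖1 - w‖ = ‖ω * (v * (1 - w))‖ := by rw [norm_mul, norm_mul, hω, hvn, one_mul, one_mul]
      _ = ‖(1 - ω * u) - (1 - ω * v)‖ := by congr 1; rw [← h3]; ring
      _ ≤ _ := norm_sub_le _ _
  calc ‖1 - w‖ ^ 2 ≤ 2 * ‖1 - ω * u‖ ^ 2 + 2 * ‖1 - ω * v‖ ^ 2 := by
        nlinarith [norm_nonneg (1 - w), norm_nonneg (1 - ω * u), norm_nonneg (1 - ω * v),
          sq_nonneg (‖1 - ω * u‖ - ‖1 - ω * v‖)]
    _ ≤ 2 * (2 / deltaTerm D a d * |R|) + 2 * (2 / deltaTerm D a e * |R|) := by gcongr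
    _ = _ := by ring

/-- A subgroup of ℤ has a single generator; it divides every d − min D, so the gcd condition makes
it a unit. -/
theorem decayInts_eq_top {D : Set ℕ} (hD : D.Nonempty)
    (hgcd : ∀ g : ℕ, (∀ d ∈ D, g ∣ d - sInf D) → g = 1) {a b : ℝ} (ha : 0 < a) :
    decayInts D a b = ⊤ := by
  obtain ⟨g, hg⟩ := Int.subgroup_cyclic (decayInts D a b)
  rw [← AddSubgroup.zmultiples_eq_closure] at hg
  have h1 : g.natAbs = 1 := hgcd _ fun d hd => by
    have h := sub_mem_decayInts (b := b) ha hd (Nat.sInf_mem hD)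
    rw [hg, Int.mem_zmultiples_iff, ← Nat.cast_sub (Nat.sInf_le hd), ← Int.natAbs_dvd] at h
    exact_mod_cast h
  rw [hg, ← Int.zmultiples_natAbs, h1, Nat.cast_one, Int.zmultiples_one]

theorem norm_one_sub_exp_ge {θ : ℝ} (hθ : |θ| ≤ Real.pi) :
    2 / Real.pi * |θ| ≤ ‖1 - Complex.exp ((θ : ℂ) * ((1 : ℤ) : ℝ) * Complex.I)‖ := by
  have h1 : (θ : ℂ) * ((1 : ℤ) : ℝ) * Complex.I = Complex.I * θ := by push_cast; ring
  rw [h1, norm_sub_rev, Complex.norm_exp_I_mul_ofReal_sub_one, norm_mul, Real.norm_eq_abs,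
    Real.norm_eq_abs, abs_two]
  have h2 := Real.mul_abs_le_abs_sin (x := θ / 2) (by
    rw [abs_div, abs_two]; exact div_le_div_of_nonneg_right hθ zero_le_two)
  rw [abs_div, abs_two] at h2
  linarith

theorem norm_charFn_le {D : Set ℕ} (hD : D.Nonempty)
    (hgcd : ∀ g : ℕ, (∀ d ∈ D, g ∣ d - sInf D) → g = 1) {a b : ℝ} (ha : 0 < a) (hab : a ≤ b) :
    ∃ c, 0 < c ∧ ∀ x, a ≤ x → x ≤ b → ∀ θ, |θ| ≤ Real.pi →
      ‖charFn D x θ‖ ≤ Real.exp (-(c * θ ^ 2)) := by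
  obtain ⟨C, hC, h⟩ : (1 : ℤ) ∈ decayInts D a b := by
    rw [decayInts_eq_top hD hgcd ha]; trivial
  have hb : 0 < Delta ℝ D b := delta_pos hD (ha.trans_le hab)
  have hpi := Real.pi_pos
  -- C + 1 instead of C, because C is only known to be nonnegative. The factor (2/π)² comes from |1
  -- − e^{iθ}| ≥ (2/π)|θ|.
  refine ⟨(2 / Real.pi) ^ 2 / ((C + 1) * Delta ℝ D b), by positivity, fun x hax hxb θ hθ => ?_⟩
  have hx := ha.trans_le hax
  have hxD : 0 < Delta ℝ D x := delta_pos hD hx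
  have h1 := h x hax hxb θ
  have h2 := norm_one_sub_exp_ge hθ
  have hR0 : 0 ≤ Delta ℝ D x - ‖Delta ℂ D ((x : ℂ) * Complex.exp (θ * Complex.I))‖ := by
    rw [sub_nonneg, ← (hasSum_delta D _).tsum_eq]
    refine tsum_of_norm_bounded (hasSum_delta D x) fun d => ?_
    rw [norm_deltaTerm, norm_mul, Complex.norm_exp_ofReal_mul_I, mul_one,
      Complex.norm_of_nonneg hx.le]
  rw [abs_of_nonneg hR0] at h1
  set R := Delta ℝ D x - ‖Delta ℂ D ((x : ℂ) * Complex.exp (θ * Complex.I))‖ with hR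
  have h3 : (2 / Real.pi) ^ 2 * θ ^ 2 ≤ (C + 1) * R := by
    calc (2 / Real.pi) ^ 2 * θ ^ 2 = (2 / Real.pi * |θ|) ^ 2 := by rw [mul_pow, sq_abs]
      _ ≤ _ := pow_le_pow_left₀ (by positivity) h2 2
      _ ≤ C * R := h1
      _ ≤ (C + 1) * R := by gcongr; linarith
  have h4 : (2 / Real.pi) ^ 2 / ((C + 1) * Delta ℝ D b) * θ ^ 2 ≤ R / Delta ℝ D x := by
    rw [div_mul_eq_mul_div, div_le_div_iff₀ (by positivity) hxD]
    calc (2 / Real.pi) ^ 2 * θ ^ 2 * Delta ℝ D x ≤ (C + 1) * R * Delta ℝ D b := by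
          gcongr
          exact delta_mono D hx.le hxb
      _ = _ := by ring
  have h5 : ‖charFn D x θ‖ = 1 - R / Delta ℝ D x := by
    rw [charFn, norm_div, Complex.norm_of_nonneg hxD.le, hR]
    field_simp
    ring
  rw [h5]
  calc 1 - R / Delta ℝ D x ≤ -((2 / Real.pi) ^ 2 / ((C + 1) * Delta ℝ D b) * θ ^ 2) + 1 := by
        linarith
    _ ≤ _ := Real.add_one_le_exp _

/-- A bound for every j, however far from the mean; it controls the corrections with unbounded
indices. -/
theorem sumProb_le {D : Set ℕ} {x c : ℝ} (hx : 0 ≤ x) (hc : 0 < c)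
    (h : ∀ θ, |θ| ≤ Real.pi → ‖charFn D x θ‖ ≤ Real.exp (-(c * θ ^ 2))) {N : ℕ} (hN : 0 < N)
    (j : ℕ) : sumProb D N x j ≤ (2 * Real.pi)⁻¹ * √(Real.pi / c) / √N := by
  have hpi := Real.pi_pos
  have hN' : (0 : ℝ) < N := Nat.cast_pos.2 hN
  have h1 : sumProb D N x j = ‖(sumProb D N x j : ℂ)‖ := by
    rw [Complex.norm_of_nonneg (sumProb_nonneg hx N j)]
  have hint : MeasureTheory.Integrable (fun θ : ℝ => Real.exp (-(c * N) * θ ^ 2)) :=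
    integrable_exp_neg_mul_sq (by positivity)
  have h2 : ‖∫ θ in (-Real.pi)..Real.pi,
      charFn D x θ ^ N * Complex.exp (-((j : ℂ) * Complex.I * θ))‖ ≤
      ∫ θ in (-Real.pi)..Real.pi, Real.exp (-(c * N) * θ ^ 2) := by
    refine intervalIntegral.norm_integral_le_of_norm_le (by linarith) ?_
      hint.intervalIntegrable
    refine Eventually.of_forall fun θ hθ => ?_
    have h3 : -((j : ℂ) * Complex.I * θ) = ((-(j * θ) : ℝ) : ℂ) * Complex.I := by push_cast; ring
    rw [norm_mul, h3, Complex.norm_exp_ofReal_mul_I, mul_one, norm_pow]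
    calc ‖charFn D x θ‖ ^ N ≤ Real.exp (-(c * θ ^ 2)) ^ N := by
          gcongr
          exact h θ (abs_le.2 ⟨hθ.1.le, hθ.2⟩)
      _ = _ := by rw [← Real.exp_nat_mul]; congr 1; ring
  have h4 : ∫ θ in (-Real.pi)..Real.pi, Real.exp (-(c * N) * θ ^ 2) ≤ √(Real.pi / (c * N)) := by
    rw [← integral_gaussian, intervalIntegral.integral_of_le (by linarith)]
    exact MeasureTheory.setIntegral_le_integral hint
      (Eventually.of_forall fun θ => (Real.exp_pos _).le)
  rw [h1, sumProb_eq_integral, norm_mul, norm_inv, norm_mul, Complex.norm_of_nonneg hpi.le,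
    Complex.norm_ofNat, mul_div_assoc, ← Real.sqrt_div' _ hN'.le, div_div]
  gcongr
  exact h2.trans h4

/-! ### The local limit theorem -/

/-- Needed for all real y, since d is unbounded in the dominated convergence below. -/
theorem norm_exp_mul_I_sub_one_sub_le (y : ℝ) :
    ‖Complex.exp (y * Complex.I) - 1 - y * Complex.I‖ ≤ 3 * y ^ 2 := by
  have hy : ‖(y : ℂ) * Complex.I‖ = |y| := by simp
  rcases le_or_gt |y| 1 with h | h
  · have := Complex.norm_exp_sub_one_sub_id_le (x := (y : ℂ) * Complex.I) (hy.le.trans h)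
    rw [hy, sq_abs] at this
    nlinarith [sq_nonneg y]
  · calc ‖Complex.exp (y * Complex.I) - 1 - y * Complex.I‖
        ≤ ‖Complex.exp (y * Complex.I)‖ + ‖(1 : ℂ)‖ + ‖(y : ℂ) * Complex.I‖ :=
          (norm_sub_le _ _).trans (by gcongr; exact norm_sub_le _ _)
      _ = 1 + 1 + |y| := by rw [Complex.norm_exp_ofReal_mul_I, norm_one, hy]
      _ ≤ 3 * |y| ^ 2 := by nlinarith
      _ = 3 * y ^ 2 := by rw [sq_abs]

theorem tendsto_natCast_mul_exp_sub {y : ℕ → ℝ} {u : ℝ}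
    (h : Tendsto (fun n : ℕ => √n * y n) atTop (𝓝 u)) :
    Tendsto (fun n : ℕ => (n : ℂ) * (Complex.exp (y n * Complex.I) - 1 - y n * Complex.I)) atTop
      (𝓝 ((-(u ^ 2 / 2) : ℝ) : ℂ)) := by
  have hsq : Tendsto (fun n : ℕ => √(n : ℝ)) atTop atTop :=
    Real.tendsto_sqrt_atTop.comp tendsto_natCast_atTop_atTop
  have hy0 : Tendsto y atTop (𝓝 0) := by
    have h1 := h.mul hsq.inv_tendsto_atTop
    rw [mul_zero] at h1
    refine h1.congr' ?_
    filter_upwards [hsq.eventually_gt_atTop 0] with n hn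
    simp only [Pi.inv_apply]
    field_simp
  have hz : Tendsto (fun n => (y n : ℂ) * Complex.I) atTop (𝓝 0) := by
    have h1 : Tendsto (fun n => (y n : ℂ)) atTop (𝓝 ((0 : ℝ) : ℂ)) :=
      (Complex.continuous_ofReal.tendsto 0).comp hy0
    simpa using h1.mul_const Complex.I
  have hny : ∀ n : ℕ, (n : ℂ) * ((y n : ℂ) * Complex.I) ^ 2 = ((-(√n * y n) ^ 2 : ℝ) : ℂ) := by
    intro n
    rw [mul_pow, mul_pow, Complex.I_sq, Real.sq_sqrt (Nat.cast_nonneg n)]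
    push_cast
    ring
  have hlim : Tendsto (fun n : ℕ => (n : ℂ) * ((y n : ℂ) * Complex.I) ^ 2) atTop
      (𝓝 ((-u ^ 2 : ℝ) : ℂ)) := by
    simp only [hny]
    exact (Complex.continuous_ofReal.tendsto _).comp (h.pow 2).neg
  have ho := (Complex.exp_sub_sum_range_succ_isLittleO_pow 2).comp_tendsto hz
  have ho' : (fun n : ℕ => (n : ℂ) * (Complex.exp (y n * Complex.I) -
      ∑ i ∈ Finset.range 3, ((y n : ℂ) * Complex.I) ^ i / i.factorial)) =o[atTop]
      fun _ : ℕ => (1 : ℂ) :=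
    ((isBigO_refl (fun n : ℕ => (n : ℂ)) atTop).mul_isLittleO ho).trans_isBigO
      (hlim.isBigO_one ℂ)
  have h2 := ((isLittleO_one_iff ℂ).1 ho').add (hlim.div_const 2)
  rw [zero_add] at h2
  have h3 : ((-u ^ 2 : ℝ) : ℂ) / 2 = ((-(u ^ 2 / 2) : ℝ) : ℂ) := by push_cast; ring
  rw [h3] at h2
  refine h2.congr fun n => ?_
  simp only [Finset.sum_range_succ, Finset.sum_range_zero]
  norm_num
  ring

/-- The characteristic function of the centred Boltzmann distribution. -/
def centredCharFn (D : Set ℕ) (x θ : ℝ) : ℂ :=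
  charFn D x θ * Complex.exp (((-(mean D x * θ) : ℝ) : ℂ) * Complex.I)

theorem continuous_centredCharFn (D : Set ℕ) (x : ℝ) : Continuous (centredCharFn D x) :=
  (continuous_charFn D x).mul (by fun_prop)

theorem norm_centredCharFn (D : Set ℕ) (x θ : ℝ) : ‖centredCharFn D x θ‖ = ‖charFn D x θ‖ := by
  rw [centredCharFn, norm_mul, Complex.norm_exp_ofReal_mul_I, mul_one]

/-- The weights of the Boltzmann distribution. -/
def boltzmann (D : Set ℕ) (x : ℝ) (d : ℕ) : ℝ := deltaTerm D x d / Delta ℝ D x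

theorem boltzmann_nonneg {D : Set ℕ} (hD : D.Nonempty) {x : ℝ} (hx : 0 < x) (d : ℕ) :
    0 ≤ boltzmann D x d :=
  div_nonneg (deltaTerm_nonneg D hx.le d) (delta_pos hD hx).le

theorem hasSum_boltzmann {D : Set ℕ} (hD : D.Nonempty) {x : ℝ} (hx : 0 < x) :
    HasSum (boltzmann D x) 1 := by
  have h := (hasSum_delta D x).div_const (Delta ℝ D x)
  rwa [div_self (delta_pos hD hx).ne'] at h

theorem hasSum_boltzmann_centred {D : Set ℕ} (hD : D.Nonempty) {x : ℝ} (hx : 0 < x) :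
    HasSum (fun d : ℕ => boltzmann D x d * ((d : ℝ) - mean D x)) 0 := by
  have h := (hasSum_sub_mul_deltaTerm D x (mean D x)).div_const (Delta ℝ D x)
  rw [mean_mul_delta hD hx, zero_div] at h
  exact h.congr_fun fun d => by rw [boltzmann]; ring

/-- The weights have total mass 1 and centred mean 0, so subtracting the linear Taylor part removes
just 1 in total and leaves terms quadratic in θ. -/
theorem hasSum_centredCharFn {D : Set ℕ} (hD : D.Nonempty) {x : ℝ} (hx : 0 < x) (θ : ℝ) :
    HasSum (fun d : ℕ => ((boltzmann D x d : ℝ) : ℂ) *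
      (Complex.exp (((θ * ((d : ℝ) - mean D x) : ℝ) : ℂ) * Complex.I) - 1 -
        ((θ * ((d : ℝ) - mean D x) : ℝ) : ℂ) * Complex.I)) (centredCharFn D x θ - 1) := by
  have h1 := ((hasSum_delta D ((x : ℂ) * Complex.exp (θ * Complex.I))).div_const
    (Delta ℝ D x : ℂ)).mul_right (Complex.exp (((-(mean D x * θ) : ℝ) : ℂ) * Complex.I))
  have h2 := Complex.hasSum_ofReal.2 (hasSum_boltzmann hD hx)
  have h3 := (Complex.hasSum_ofReal.2 (hasSum_boltzmann_centred hD hx)).mul_right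
    ((θ : ℂ) * Complex.I)
  have h4 := (h1.sub h2).sub h3
  rw [Complex.ofReal_zero, zero_mul, sub_zero, Complex.ofReal_one] at h4
  refine h4.congr_fun fun d => ?_
  have h5 : Complex.exp (((θ * ((d : ℝ) - mean D x) : ℝ) : ℂ) * Complex.I) =
      Complex.exp ((θ : ℂ) * (d : ℝ) * Complex.I) *
        Complex.exp (((-(mean D x * θ) : ℝ) : ℂ) * Complex.I) := by
    rw [← Complex.exp_add]
    congr 1
    push_cast
    ring
  rw [h5, deltaTerm_mul_exp, boltzmann]
  push_cast
  ring

/-- The variance of the Boltzmann distribution. -/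
def boltzmannVar (D : Set ℕ) (x : ℝ) : ℝ :=
  ∑' d : ℕ, boltzmann D x d * ((d : ℝ) - mean D x) ^ 2

theorem add_sq_le_four_pow {M : ℝ} (hM : 0 ≤ M) (d : ℕ) :
    ((d : ℝ) + M) ^ 2 ≤ (1 + M) ^ 2 * 4 ^ d := by
  have h1 : (d : ℝ) ≤ 2 ^ d := by exact_mod_cast (Nat.lt_two_pow_self).le
  have h2 : (1 : ℝ) ≤ 2 ^ d := one_le_pow₀ one_le_two
  calc ((d : ℝ) + M) ^ 2 ≤ ((1 + M) * 2 ^ d) ^ 2 := by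
        gcongr
        nlinarith
    _ = (1 + M) ^ 2 * 4 ^ d := by rw [mul_pow, ← pow_mul, mul_comm d 2, pow_mul]; norm_num

/-- A bound for the terms of second moments that is uniform over `x ∈ [a, b]`. -/
theorem boltzmann_mul_sq_le {D : Set ℕ} (hD : D.Nonempty) {a b M x : ℝ} (ha : 0 < a)
    (hax : a ≤ x) (hxb : x ≤ b) (hM : |mean D x| ≤ M) (d : ℕ) :
    boltzmann D x d * ((d : ℝ) - mean D x) ^ 2 ≤
      (1 + M) ^ 2 / Delta ℝ D a * deltaTerm D (4 * b) d := by
  have hx := ha.trans_le hax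
  have hda := delta_pos hD ha
  have h1 : ((d : ℝ) - mean D x) ^ 2 ≤ (1 + M) ^ 2 * 4 ^ d := by
    refine le_trans ?_ (add_sq_le_four_pow ((abs_nonneg _).trans hM) d)
    rw [← sq_abs]
    have h2 : |(d : ℝ) - mean D x| ≤ (d : ℝ) + M :=
      (abs_sub _ _).trans (by rw [abs_of_nonneg (Nat.cast_nonneg d)]; gcongr)
    gcongr
  have h3 : boltzmann D x d ≤ deltaTerm D b d / Delta ℝ D a := by
    have := delta_mono D ha.le hax
    have := deltaTerm_mono D hx.le hxb d
    have := deltaTerm_nonneg D (hx.le.trans hxb) d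
    unfold boltzmann
    gcongr
  calc boltzmann D x d * ((d : ℝ) - mean D x) ^ 2
      ≤ deltaTerm D b d / Delta ℝ D a * ((1 + M) ^ 2 * 4 ^ d) :=
        mul_le_mul h3 h1 (sq_nonneg _) ((boltzmann_nonneg hD hx d).trans h3)
    _ = _ := by rw [deltaTerm_mul]; ring

theorem boltzmannVar_pos {D : Set ℕ} (hD : D.Nontrivial) {x : ℝ} (hx : 0 < x) :
    0 < boltzmannVar D x := by
  obtain ⟨d, hd, hdt⟩ : ∃ d ∈ D, (d : ℝ) ≠ mean D x := by
    obtain ⟨a, ha, b, hb, hab⟩ := hD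
    by_cases h : (a : ℝ) = mean D x
    · exact ⟨b, hb, fun h' => hab (by exact_mod_cast h.trans h'.symm)⟩
    · exact ⟨a, ha, h⟩
  have h0 : ∀ d : ℕ, 0 ≤ boltzmann D x d * ((d : ℝ) - mean D x) ^ 2 := fun d =>
    mul_nonneg (boltzmann_nonneg hD.nonempty hx d) (sq_nonneg _)
  refine Summable.tsum_pos (Summable.of_nonneg_of_le h0
    (boltzmann_mul_sq_le hD.nonempty hx le_rfl le_rfl le_rfl)
    ((summable_deltaTerm_real D _).mul_left _)) h0 d ?_
  exact mul_pos (div_pos (deltaTerm_pos hx hd) (delta_pos hD.nonempty hx))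
    (sq_pos_of_ne_zero (sub_ne_zero.2 hdt))

/-- Second-order Taylor expansion in each term and dominated convergence over d. The parameter moves
with n, so the majorant is taken uniform over [x₀/2, 2x₀]. -/
theorem tendsto_natCast_mul_centredCharFn {D : Set ℕ} (hD : D.Nonempty) {x : ℕ → ℝ} {x₀ : ℝ}
    (hx : Tendsto x atTop (𝓝 x₀)) (h0 : 0 < x₀) (t : ℝ) :
    Tendsto (fun n : ℕ => (n : ℂ) * (centredCharFn D (x n) (t / √n) - 1)) atTop
      (𝓝 ((-(boltzmannVar D x₀ / 2 * t ^ 2) : ℝ) : ℂ)) := by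
  have hmean : Tendsto (fun n => mean D (x n)) atTop (𝓝 (mean D x₀)) :=
    (((continuousOn_mean hD).continuousAt (Ioi_mem_nhds h0)).tendsto).comp hx
  set M := |mean D x₀| + 1 with hM
  have hM' : ∀ᶠ n in atTop, |mean D (x n)| ≤ M :=
    (hmean.abs.eventually (gt_mem_nhds (lt_add_one |mean D x₀|))).mono fun n h => h.le
  have hxa : ∀ᶠ n in atTop, x₀ / 2 ≤ x n :=
    (hx.eventually (lt_mem_nhds (half_lt_self h0))).mono fun n h => h.le
  have hxb : ∀ᶠ n in atTop, x n ≤ 2 * x₀ :=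
    (hx.eventually (gt_mem_nhds (show x₀ < 2 * x₀ by linarith))).mono fun n h => h.le
  have key := tendsto_tsum_of_dominated_convergence (𝓕 := atTop)
    (f := fun (n : ℕ) (d : ℕ) => (n : ℂ) * (((boltzmann D (x n) d : ℝ) : ℂ) *
      (Complex.exp (((t / √n * ((d : ℝ) - mean D (x n)) : ℝ) : ℂ) * Complex.I) - 1 -
        ((t / √n * ((d : ℝ) - mean D (x n)) : ℝ) : ℂ) * Complex.I)))
    (g := fun d : ℕ => ((boltzmann D x₀ d : ℝ) : ℂ) *
      ((-((t * ((d : ℝ) - mean D x₀)) ^ 2 / 2) : ℝ) : ℂ))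
    (bound := fun d => 3 * t ^ 2 * ((1 + M) ^ 2 / Delta ℝ D (x₀ / 2) *
      deltaTerm D (4 * (2 * x₀)) d))
    (((summable_deltaTerm_real D _).mul_left _).mul_left _) ?_ ?_
  · have h1 : ∑' d : ℕ, ((boltzmann D x₀ d : ℝ) : ℂ) *
        ((-((t * ((d : ℝ) - mean D x₀)) ^ 2 / 2) : ℝ) : ℂ) =
        ((-(boltzmannVar D x₀ / 2 * t ^ 2) : ℝ) : ℂ) := by
      rw [boltzmannVar, div_mul_eq_mul_div, ← tsum_mul_right, ← tsum_div_const, ← tsum_neg,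
        Complex.ofReal_tsum]
      refine tsum_congr fun d => ?_
      push_cast
      ring
    rw [h1] at key
    refine key.congr' ?_
    filter_upwards [hxa] with n hn
    rw [tsum_mul_left, (hasSum_centredCharFn hD ((half_pos h0).trans_le hn) _).tsum_eq]
  · intro d
    have h1 : Tendsto (fun n => ((boltzmann D (x n) d : ℝ) : ℂ)) atTop
        (𝓝 ((boltzmann D x₀ d : ℝ) : ℂ)) := by
      refine (Complex.continuous_ofReal.tendsto _).comp ?_
      refine Tendsto.div ?_ (((continuous_delta D).tendsto x₀).comp hx) (delta_pos hD h0).ne'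
      by_cases hd : d ∈ D
      · simp only [deltaTerm_of_mem _ hd]
        exact (hx.pow d).div_const _
      · simp only [deltaTerm_of_notMem _ hd]
        exact tendsto_const_nhds
    have h2 := tendsto_natCast_mul_exp_sub (y := fun n : ℕ => t / √n * ((d : ℝ) - mean D (x n)))
      (u := t * ((d : ℝ) - mean D x₀)) (by
        refine ((tendsto_const_nhds.sub hmean).const_mul t).congr' ?_
        filter_upwards [eventually_gt_atTop 0] with n hn
        have : √(n : ℝ) ≠ 0 := (Real.sqrt_pos.2 (Nat.cast_pos.2 hn)).ne'
        field_simp)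
    exact (h1.mul h2).congr fun n => by ring
  · filter_upwards [hxa, hxb, hM', eventually_gt_atTop 0] with n h1 h2 h3 hn d
    have hb := boltzmann_mul_sq_le hD (half_pos h0) h1 h2 h3 d
    have hbn := boltzmann_nonneg hD ((half_pos h0).trans_le h1) d
    rw [norm_mul, norm_mul, Complex.norm_natCast, Complex.norm_of_nonneg hbn]
    calc (n : ℝ) * (boltzmann D (x n) d * _)
        ≤ n * (boltzmann D (x n) d * (3 * (t / √n * ((d : ℝ) - mean D (x n))) ^ 2)) := by
          gcongr
          exact norm_exp_mul_I_sub_one_sub_le _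
      _ = 3 * t ^ 2 * (boltzmann D (x n) d * ((d : ℝ) - mean D (x n)) ^ 2) := by
          rw [mul_pow, div_pow, Real.sq_sqrt (Nat.cast_nonneg n)]
          have : (n : ℝ) ≠ 0 := (Nat.cast_pos.2 hn).ne'
          field_simp
      _ ≤ _ := by gcongr

/-- (1 + aₙ/n)^n tends to e^a when aₙ tends to a; the k missing factors tend to 1. -/
theorem tendsto_centredCharFn_pow {D : Set ℕ} (hD : D.Nonempty) {x : ℕ → ℝ} {x₀ : ℝ}
    (hx : Tendsto x atTop (𝓝 x₀)) (h0 : 0 < x₀) (t : ℝ) (k : ℕ) :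
    Tendsto (fun n : ℕ => centredCharFn D (x n) (t / √n) ^ (n - k)) atTop
      (𝓝 (Complex.exp ((-(boltzmannVar D x₀ / 2 * t ^ 2) : ℝ) : ℂ))) := by
  have h := tendsto_natCast_mul_centredCharFn hD hx h0 t
  have h1 := Complex.tendsto_one_add_pow_exp_of_tendsto h
  simp only [add_sub_cancel] at h1
  have h2 : Tendsto (fun n : ℕ => centredCharFn D (x n) (t / √n)) atTop (𝓝 1) := by
    have h3 := h.mul (tendsto_inv_atTop_nhds_zero_nat (𝕜 := ℂ))
    rw [mul_zero] at h3
    have h4 := h3.add_const 1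
    rw [zero_add] at h4
    refine h4.congr' ?_
    filter_upwards [eventually_gt_atTop 0] with n hn
    have : (n : ℂ) ≠ 0 := Nat.cast_ne_zero.2 hn.ne'
    field_simp
    ring
  have h5 := h1.div (h2.pow k) (by simp)
  rw [one_pow, div_one] at h5
  refine h5.congr' ?_
  filter_upwards [eventually_ge_atTop k, h2.eventually_ne one_ne_zero] with n hn hne
  rw [Pi.div_apply, pow_sub₀ _ hne hn, div_eq_mul_inv]

/-- Substituting t = θ√n in the inversion integral. As n · mean = 2m exactly, centring cancels the
main phase and leaves only (r − k · mean)θ. -/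
theorem sqrt_mul_sumProb_eq {D : Set ℕ} {n k r m : ℕ} {x : ℝ} (hn : 0 < n) (hk : k ≤ n)
    (hr : r ≤ 2 * m) (hm : mean D x = 2 * (m : ℝ) / n) :
    ((√n * sumProb D (n - k) x (2 * m - r) : ℝ) : ℂ) = (2 * (Real.pi : ℂ))⁻¹ *
      ∫ t, Set.indicator (Set.Ioc (-Real.pi * √n) (Real.pi * √n))
        (fun t => centredCharFn D x (t / √n) ^ (n - k) *
          Complex.exp (((((r : ℝ) - k * mean D x) * (t / √n) : ℝ) : ℂ) * Complex.I)) t := by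
  have hs : 0 < √(n : ℝ) := Real.sqrt_pos.2 (Nat.cast_pos.2 hn)
  have hn' : (n : ℝ) ≠ 0 := (Nat.cast_pos.2 hn).ne'
  have hint : ∀ θ : ℝ, charFn D x θ ^ (n - k) *
      Complex.exp (-(((2 * m - r : ℕ) : ℂ) * Complex.I * θ)) = centredCharFn D x θ ^ (n - k) *
          Complex.exp (((((r : ℝ) - k * mean D x) * θ : ℝ) : ℂ) * Complex.I) := by
    intro θ
    rw [centredCharFn, mul_pow, ← Complex.exp_nat_mul, mul_assoc (charFn D x θ ^ (n - k)),
      ← Complex.exp_add]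
    congr 2
    have h1 : (((n - k : ℕ) : ℝ) * (-(mean D x * θ)) + ((r : ℝ) - k * mean D x) * θ : ℝ) =
        -(((2 * m - r : ℕ) : ℝ) * θ) := by
      rw [Nat.cast_sub hk, Nat.cast_sub hr, hm]
      push_cast
      field_simp
      ring
    have h2 := congrArg (fun y : ℝ => (y : ℂ) * Complex.I) h1
    push_cast at h2 ⊢
    linear_combination -h2
  rw [Complex.ofReal_mul, sumProb_eq_integral, MeasureTheory.integral_indicator measurableSet_Ioc,
    ← intervalIntegral.integral_of_le (by nlinarith [Real.pi_pos])]
  simp only [hint]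
  have h := intervalIntegral.integral_comp_div (a := -Real.pi * √n) (b := Real.pi * √n)
    (fun θ : ℝ => centredCharFn D x θ ^ (n - k) *
          Complex.exp (((((r : ℝ) - k * mean D x) * θ : ℝ) : ℂ) * Complex.I)) hs.ne'
  rw [mul_div_cancel_right₀ _ hs.ne', mul_div_cancel_right₀ _ hs.ne', Complex.real_smul] at h
  rw [h]
  ring

theorem tendsto_sqrt_mul_sumProb {D : Set ℕ} (hD : D.Nontrivial)
    (hgcd : ∀ g : ℕ, (∀ d ∈ D, g ∣ d - sInf D) → g = 1) {x : ℕ → ℝ} {x₀ : ℝ}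
    (hx : Tendsto x atTop (𝓝 x₀)) (h0 : 0 < x₀) {m : ℕ → ℕ}
    (hm : ∀ᶠ n in atTop, mean D (x n) = 2 * (m n : ℝ) / (n : ℝ))
    (hm' : Tendsto m atTop atTop) (k r : ℕ) :
    Tendsto (fun n : ℕ => √n * sumProb D (n - k) (x n) (2 * m n - r)) atTop
      (𝓝 ((2 * Real.pi)⁻¹ * √(Real.pi / (boltzmannVar D x₀ / 2)))) := by
  obtain ⟨c, hc, hbound⟩ := norm_charFn_le hD.nonempty hgcd (half_pos h0)
    (show x₀ / 2 ≤ 2 * x₀ by linarith)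
  have hxa : ∀ᶠ n in atTop, x₀ / 2 ≤ x n :=
    (hx.eventually (lt_mem_nhds (half_lt_self h0))).mono fun n h => h.le
  have hxb : ∀ᶠ n in atTop, x n ≤ 2 * x₀ :=
    (hx.eventually (gt_mem_nhds (show x₀ < 2 * x₀ by linarith))).mono fun n h => h.le
  have hmean : Tendsto (fun n => mean D (x n)) atTop (𝓝 (mean D x₀)) :=
    (((continuousOn_mean hD.nonempty).continuousAt (Ioi_mem_nhds h0)).tendsto).comp hx
  have hsq : Tendsto (fun n : ℕ => √(n : ℝ)) atTop atTop :=
    Real.tendsto_sqrt_atTop.comp tendsto_natCast_atTop_atTop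
  have key : Tendsto (fun n : ℕ => ∫ t, Set.indicator (Set.Ioc (-Real.pi * √n) (Real.pi * √n))
        (fun t => centredCharFn D (x n) (t / √n) ^ (n - k) *
          Complex.exp (((((r : ℝ) - k * mean D (x n)) * (t / √n) : ℝ) : ℂ) * Complex.I)) t) atTop
      (𝓝 (∫ t : ℝ, Complex.exp ((-(boltzmannVar D x₀ / 2 * t ^ 2) : ℝ) : ℂ))) := by
    refine MeasureTheory.tendsto_integral_filter_of_dominated_convergence
      (fun t => Real.exp (-(c / 2) * t ^ 2)) ?_ ?_ (integrable_exp_neg_mul_sq (half_pos hc)) ?_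
    · refine Eventually.of_forall fun n => ?_
      refine (Continuous.aestronglyMeasurable ?_).indicator measurableSet_Ioc
      exact (((continuous_centredCharFn D (x n)).comp (by fun_prop)).pow _).mul (by fun_prop)
    -- For n > 2k the ratio (n − k)/n is at least 1/2, so the Gaussian with c/2 dominates.
    · filter_upwards [hxa, hxb, eventually_ge_atTop (2 * k + 1)] with n h1 h2 hn
      refine Eventually.of_forall fun t => ?_
      have hn0 : (0 : ℝ) < n := Nat.cast_pos.2 (by omega)
      have hs : 0 < √(n : ℝ) := Real.sqrt_pos.2 hn0
      rw [norm_indicator_eq_indicator_norm]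
      refine Set.indicator_apply_le' (fun ht => ?_) (fun _ => (Real.exp_pos _).le)
      rw [norm_mul, Complex.norm_exp_ofReal_mul_I, mul_one, norm_pow, norm_centredCharFn]
      have hθ : |t / √n| ≤ Real.pi := by
        rw [abs_div, abs_of_pos hs, div_le_iff₀ hs, abs_le]
        exact ⟨by linarith [ht.1], ht.2⟩
      calc ‖charFn D (x n) (t / √n)‖ ^ (n - k)
          ≤ Real.exp (-(c * (t / √n) ^ 2)) ^ (n - k) := by
            gcongr
            exact hbound _ h1 h2 _ hθ
        _ = Real.exp (-(c * ((n - k : ℕ) / n) * t ^ 2)) := by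
            rw [← Real.exp_nat_mul, div_pow, Real.sq_sqrt hn0.le]
            congr 1
            field_simp
        _ ≤ _ := by
            rw [Real.exp_le_exp, neg_mul]
            have h3 : (1 : ℝ) / 2 ≤ ((n - k : ℕ) : ℝ) / n := by
              rw [div_le_div_iff₀ two_pos hn0, Nat.cast_sub (by omega)]
              have : (2 * k + 1 : ℝ) ≤ n := by exact_mod_cast hn
              linarith
            have h4 : c / 2 ≤ c * (((n - k : ℕ) : ℝ) / n) := by
              calc c / 2 = c * (1 / 2) := by ring
                _ ≤ _ := by gcongr
            have := mul_le_mul_of_nonneg_right h4 (sq_nonneg t)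
            linarith
    · refine Eventually.of_forall fun t => ?_
      have h1 := tendsto_centredCharFn_pow hD.nonempty hx h0 t k
      have h2 : Tendsto (fun n : ℕ => Complex.exp
          (((((r : ℝ) - k * mean D (x n)) * (t / √n) : ℝ) : ℂ) * Complex.I)) atTop (𝓝 1) := by
        have h3 : Tendsto (fun n : ℕ => ((r : ℝ) - k * mean D (x n)) * (t / √n)) atTop (𝓝 0) := by
          have := (tendsto_const_nhds (x := (r : ℝ))).sub (hmean.const_mul (k : ℝ))
          simpa using this.mul (hsq.const_div_atTop t)
        have h4 : Continuous fun y : ℝ => Complex.exp ((y : ℂ) * Complex.I) := by fun_prop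
        have h5 := (h4.tendsto 0).comp h3
        rw [Complex.ofReal_zero, zero_mul, Complex.exp_zero] at h5
        exact h5
      have h3 := h1.mul h2
      rw [mul_one] at h3
      refine h3.congr' ?_
      have hpi : Tendsto (fun n : ℕ => Real.pi * √(n : ℝ)) atTop atTop :=
        hsq.const_mul_atTop Real.pi_pos
      filter_upwards [hpi.eventually_gt_atTop |t|] with n hn
      rw [Set.indicator_of_mem]
      have := abs_lt.1 hn
      exact ⟨by linarith [this.1], this.2.le⟩
  have hgauss : ∫ t : ℝ, Complex.exp ((-(boltzmannVar D x₀ / 2 * t ^ 2) : ℝ) : ℂ) =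
      ((√(Real.pi / (boltzmannVar D x₀ / 2)) : ℝ) : ℂ) := by
    rw [← integral_gaussian, ← integral_complex_ofReal]
    refine MeasureTheory.integral_congr_ae (Eventually.of_forall fun t => ?_)
    simp only [Complex.ofReal_exp]
    congr 2
    ring
  rw [hgauss] at key
  have h := (Complex.continuous_re.tendsto _).comp (key.const_mul (2 * (Real.pi : ℂ))⁻¹)
  have hre : ((2 * (Real.pi : ℂ))⁻¹ * ((√(Real.pi / (boltzmannVar D x₀ / 2)) : ℝ) : ℂ)).re =
      (2 * Real.pi)⁻¹ * √(Real.pi / (boltzmannVar D x₀ / 2)) := by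
    rw [← Complex.ofReal_re ((2 * Real.pi)⁻¹ * √(Real.pi / (boltzmannVar D x₀ / 2)))]
    push_cast
    rfl
  rw [hre] at h
  refine h.congr' ?_
  filter_upwards [hm, eventually_gt_atTop 0, eventually_ge_atTop k, hm'.eventually_ge_atTop r]
    with n h1 h2 h3 h4
  rw [Function.comp_apply, ← sqrt_mul_sumProb_eq h2 h3 (by omega) h1, Complex.ofReal_re]

/-! ### Correction factors -/

/-- The falling factorial `n (n - 1) ⋯ (n - k + 1)` over `n ^ k`. -/
def vertexCorrection (n k : ℕ) : ℝ := (n.descFactorial k : ℝ) / (n : ℝ) ^ k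

theorem vertexCorrection_nonneg (n k : ℕ) : 0 ≤ vertexCorrection n k := by
  unfold vertexCorrection; positivity

theorem vertexCorrection_le_one (n k : ℕ) : vertexCorrection n k ≤ 1 :=
  div_le_one_of_le₀ (by exact_mod_cast Nat.descFactorial_le_pow n k) (by positivity)

theorem tendsto_vertexCorrection (k : ℕ) :
    Tendsto (fun n => vertexCorrection n k) atTop (𝓝 1) := by
  induction k with
  | zero => simp [vertexCorrection]
  | succ k ih =>
    have h1 : Tendsto (fun n : ℕ => 1 - (k : ℝ) / n) atTop (𝓝 (1 - 0)) :=
      tendsto_const_nhds.sub (tendsto_const_div_atTop_nhds_zero_nat (k : ℝ))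
    rw [sub_zero] at h1
    have h2 := h1.mul ih
    rw [mul_one] at h2
    refine h2.congr' ?_
    filter_upwards [eventually_ge_atTop (k + 1)] with n hn
    have : (n : ℝ) ≠ 0 := Nat.cast_ne_zero.2 (by omega)
    rw [vertexCorrection, vertexCorrection, Nat.descFactorial_succ, Nat.cast_mul,
      Nat.cast_sub (by omega), pow_succ]
    field_simp

/-- The quotient of `2 ^ l m! (2 (m - l))! / (m - l)!` and `(2 m)! / (2 m) ^ l`. -/
def edgeCorrection (m l : ℕ) : ℝ :=
  (m.descFactorial l : ℝ) * 2 ^ l * (2 * (m : ℝ)) ^ l * (2 * (m - l)).factorial /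
    (2 * m).factorial

theorem edgeCorrection_nonneg (m l : ℕ) : 0 ≤ edgeCorrection m l := by
  unfold edgeCorrection; positivity

theorem tendsto_edgeCorrection (l : ℕ) : Tendsto (fun m => edgeCorrection m l) atTop (𝓝 1) := by
  induction l with
  | zero =>
    refine tendsto_const_nhds.congr fun m => ?_
    rw [edgeCorrection, Nat.descFactorial_zero, pow_zero, pow_zero, Nat.sub_zero, Nat.cast_one,
      one_mul, one_mul, one_mul, div_self (Nat.cast_ne_zero.2 (Nat.factorial_ne_zero _))]
  | succ l ih =>
    have h1 : Tendsto (fun m : ℕ => (1 - ((2 * l + 1 : ℝ) / 2) / m)⁻¹) atTop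
        (𝓝 ((1 - 0)⁻¹ : ℝ)) :=
      (tendsto_const_nhds.sub (tendsto_const_div_atTop_nhds_zero_nat _)).inv₀ (by simp)
    rw [sub_zero, inv_one] at h1
    have h2 := ih.mul h1
    rw [mul_one] at h2
    refine h2.congr' ?_
    filter_upwards [eventually_ge_atTop (l + 1)] with m hm
    obtain ⟨j, rfl⟩ := Nat.exists_eq_add_of_le hm
    have e1 : l + 1 + j - l = j + 1 := by omega
    have e2 : l + 1 + j - (l + 1) = j := by omega
    have e3 : 2 * (j + 1) = 2 * j + 1 + 1 := by ring
    rw [edgeCorrection, edgeCorrection, Nat.descFactorial_succ, e1, e2, e3, Nat.factorial_succ,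
      Nat.factorial_succ, pow_succ, pow_succ]
    have h3 : 1 - ((2 * l + 1 : ℝ) / 2) / ((l + 1 + j : ℕ) : ℝ) =
        (2 * j + 1) / (2 * ((l + 1 + j : ℕ) : ℝ)) := by
      push_cast
      field_simp
      ring
    rw [h3]
    push_cast
    field_simp
    ring

/-- Each induction step uses (2j + 2)(j + 1) ≤ (2j + 2)(2j + 1). -/
theorem descFactorial_sq_mul_le (m l : ℕ) (hl : l ≤ m) :
    m.descFactorial l ^ 2 * 2 ^ l * (2 * (m - l)).factorial ≤ (2 * m).factorial := by
  induction l with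
  | zero => simp
  | succ l ih =>
    obtain ⟨j, rfl⟩ := Nat.exists_eq_add_of_le hl
    refine le_trans ?_ (ih (by omega))
    have e1 : l + 1 + j - l = j + 1 := by omega
    have e2 : l + 1 + j - (l + 1) = j := by omega
    have e3 : 2 * (j + 1) = 2 * j + 1 + 1 := by ring
    rw [Nat.descFactorial_succ, e1, e2, e3, Nat.factorial_succ, Nat.factorial_succ]
    calc ((j + 1) * (l + 1 + j).descFactorial l) ^ 2 * 2 ^ (l + 1) * (2 * j).factorial
        = (l + 1 + j).descFactorial l ^ 2 * 2 ^ l *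
          ((2 * j + 1 + 1) * ((j + 1) * (2 * j).factorial)) := by ring
      _ ≤ _ := by gcongr; omega

theorem add_one_pow_le (m l : ℕ) (hl : l ≤ m) : ((m : ℝ) + 1) ^ l ≤ 4 * (m : ℝ) ^ l := by
  rcases Nat.eq_zero_or_pos m with rfl | hm
  · obtain rfl : l = 0 := by omega
    norm_num
  · have hm' : (0 : ℝ) < m := Nat.cast_pos.2 hm
    have h1 : (1 + 1 / (m : ℝ)) ^ l ≤ 4 := by
      calc (1 + 1 / (m : ℝ)) ^ l ≤ Real.exp (1 / m) ^ l := by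
            gcongr
            rw [add_comm]
            exact Real.add_one_le_exp _
        _ = Real.exp (l / m) := by rw [← Real.exp_nat_mul]; congr 1; ring
        _ ≤ Real.exp 1 := by
            rw [Real.exp_le_exp]
            exact div_le_one_of_le₀ (Nat.cast_le.2 hl) hm'.le
        _ ≤ 4 := by linarith [Real.exp_one_lt_d9]
    have h2 : (m : ℝ) + 1 = m * (1 + 1 / m) := by field_simp
    rw [h2, mul_pow, mul_comm]
    gcongr

theorem pow_le_four_pow_mul_descFactorial (m l : ℕ) (hl : l ≤ m) :
    (m : ℝ) ^ l ≤ 4 ^ l * (m.descFactorial l : ℝ) := by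
  induction l generalizing m with
  | zero => simp
  | succ l ih =>
    obtain ⟨m, rfl⟩ : ∃ m', m = m' + 1 := ⟨m - 1, by omega⟩
    have h1 := ih m (by omega)
    have h2 := add_one_pow_le m l (by omega)
    rw [Nat.succ_descFactorial_succ]
    push_cast
    calc ((m : ℝ) + 1) ^ (l + 1) = (m + 1) * ((m : ℝ) + 1) ^ l := by ring
      _ ≤ (m + 1) * (4 * (4 ^ l * (m.descFactorial l : ℝ))) := by
          gcongr
          exact h2.trans (by gcongr)
      _ = _ := by ring

/-- Geometric growth in l is harmless, as a larger w absorbs it. The two preceding bounds give 4^l ·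
4^l / 2^l. -/
theorem edgeCorrection_le (m l : ℕ) : edgeCorrection m l ≤ 8 ^ l := by
  rcases le_or_gt l m with hl | hl
  · have h1 : ((m.descFactorial l : ℝ)) ^ 2 * 2 ^ l * (2 * (m - l)).factorial ≤
        (2 * m).factorial := by exact_mod_cast descFactorial_sq_mul_le m l hl
    have h2 := pow_le_four_pow_mul_descFactorial m l hl
    rw [edgeCorrection, div_le_iff₀ (by positivity)]
    calc (m.descFactorial l : ℝ) * 2 ^ l * (2 * (m : ℝ)) ^ l * (2 * (m - l)).factorial
        = (m.descFactorial l : ℝ) * 2 ^ l * 2 ^ l * (2 * (m - l)).factorial * (m : ℝ) ^ l := by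
          rw [mul_pow]; ring
      _ ≤ (m.descFactorial l : ℝ) * 2 ^ l * 2 ^ l * (2 * (m - l)).factorial *
          (4 ^ l * (m.descFactorial l : ℝ)) := by gcongr
      _ = 8 ^ l * ((m.descFactorial l : ℝ) ^ 2 * 2 ^ l * (2 * (m - l)).factorial) := by
          rw [show (8 : ℝ) = 2 * 4 by norm_num, mul_pow]; ring
      _ ≤ _ := by gcongr
  · rw [edgeCorrection, Nat.descFactorial_of_lt hl]
    simp

/-- `sumProb D (n - k) x (2 m - s)`, or `0` if `2 m < s`. -/
def shiftedProb (D : Set ℕ) (x : ℝ) (n m k s : ℕ) : ℝ :=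
  if s ≤ 2 * m then sumProb D (n - k) x (2 * m - s) else 0

theorem shiftedProb_zero (D : Set ℕ) (x : ℝ) (n m : ℕ) :
    shiftedProb D x n m 0 0 = sumProb D n x (2 * m) := by
  simp [shiftedProb]

theorem sumProb_zero_le_one (D : Set ℕ) (x : ℝ) (j : ℕ) : sumProb D 0 x j ≤ 1 := by
  rw [sumProb, pow_zero, pow_zero, div_one, PowerSeries.coeff_one]
  split_ifs with h
  · simp [h]
  · simp

/-- For k < n, n ≤ (k + 1)(n − k) compares √n with √(n − k). For k ≥ n no draws remain: the
probability is at most 1 and √n ≤ 2^k. -/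
theorem shiftedProb_le {D : Set ℕ} {x C : ℝ} (hC : 1 ≤ C)
    (h : ∀ N : ℕ, 0 < N → ∀ j, sumProb D N x j ≤ C / √N) {n : ℕ} (hn : 0 < n) (m k s : ℕ) :
    shiftedProb D x n m k s ≤ C * 2 ^ k / √n := by
  have hs : 0 < √(n : ℝ) := Real.sqrt_pos.2 (Nat.cast_pos.2 hn)
  unfold shiftedProb
  split_ifs
  · rw [le_div_iff₀ hs]
    rcases lt_or_ge k n with hk | hk
    · have hnk : (0 : ℝ) < ((n - k : ℕ) : ℝ) := Nat.cast_pos.2 (by omega)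
      have h1 : √(n : ℝ) ≤ 2 ^ k * √((n - k : ℕ) : ℝ) := by
        rw [Real.sqrt_le_left (by positivity), mul_pow, Real.sq_sqrt hnk.le]
        have h2 : n ≤ (k + 1) * (n - k) := by
          obtain ⟨j, rfl⟩ := Nat.exists_eq_add_of_lt hk
          have : k + j + 1 - k = j + 1 := by omega
          rw [this]
          nlinarith
        have h3 : (n : ℝ) ≤ (k + 1) * ((n - k : ℕ) : ℝ) := by exact_mod_cast h2
        have h4 : (k : ℝ) + 1 ≤ 2 ^ k := by exact_mod_cast Nat.lt_two_pow_self
        have h5 : (1 : ℝ) ≤ 2 ^ k := one_le_pow₀ one_le_two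
        calc (n : ℝ) ≤ (k + 1) * ((n - k : ℕ) : ℝ) := h3
          _ ≤ (2 ^ k) ^ 2 * ((n - k : ℕ) : ℝ) := by
            gcongr
            nlinarith
      calc sumProb D (n - k) x (2 * m - s) * √n
          ≤ C / √((n - k : ℕ) : ℝ) * (2 ^ k * √((n - k : ℕ) : ℝ)) :=
            mul_le_mul (h _ (by omega) _) h1 hs.le (by positivity)
        _ = _ := by
            have := (Real.sqrt_pos.2 hnk).ne'
            field_simp
    · have h0 : n - k = 0 := by omega
      rw [h0]
      have h1 : √(n : ℝ) ≤ 2 ^ k := by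
        calc √(n : ℝ) ≤ n := by
              rw [Real.sqrt_le_left (by positivity)]
              have : (1 : ℝ) ≤ n := by exact_mod_cast hn
              nlinarith
          _ ≤ k := by exact_mod_cast hk
          _ ≤ 2 ^ k := by exact_mod_cast (Nat.lt_two_pow_self).le
      calc sumProb D 0 x (2 * m - s) * √n ≤ 1 * 2 ^ k :=
            mul_le_mul (sumProb_zero_le_one D x _) h1 hs.le zero_le_one
        _ ≤ _ := by gcongr
  · positivity

theorem shiftedProb_nonneg {D : Set ℕ} {x : ℝ} (hx : 0 ≤ x) (n m k s : ℕ) :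
    0 ≤ shiftedProb D x n m k s := by
  unfold shiftedProb
  split_ifs
  · exact sumProb_nonneg hx _ _
  · exact le_rfl

/-- The product of the correction factors. -/
def correction (D : Set ℕ) (x : ℝ) (n m : ℕ) (q : (ℕ × ℕ) × ℕ) : ℝ :=
  vertexCorrection n q.1.1 * edgeCorrection m q.1.2 *
    shiftedProb D x n m q.1.1 (2 * q.1.2 + q.2)

/-- The majorant of the correction factors. -/
def majorant (q : (ℕ × ℕ) × ℕ) : ℝ := 32 ^ q.1.1 * 32 ^ q.1.2 * 2 ^ q.2

/-- Inside a fixed box finitely many quotients tend to 1. Outside it k + l + r ≥ M, and the crude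
bound C' 2^k 8^l is beaten because the majorant exceeds 2^k 8^l by at least 2^M. -/
theorem correction_near {D : Set ℕ} (hD : D.Nontrivial)
    (hgcd : ∀ g : ℕ, (∀ d ∈ D, g ∣ d - sInf D) → g = 1) {x : ℕ → ℝ} {x₀ : ℝ}
    (hx : Tendsto x atTop (𝓝 x₀)) (h0 : 0 < x₀) {m : ℕ → ℕ}
    (hm : ∀ᶠ n in atTop, mean D (x n) = 2 * (m n : ℝ) / (n : ℝ))
    (hm' : Tendsto m atTop atTop) {ε : ℝ} (hε : 0 < ε) :
    ∀ᶠ n in atTop, ∀ q, |correction D (x n) n (m n) q - sumProb D n (x n) (2 * m n)| ≤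
      ε * sumProb D n (x n) (2 * m n) * majorant q := by
  set s₀ := (2 * Real.pi)⁻¹ * √(Real.pi / (boltzmannVar D x₀ / 2)) with hs₀
  have hs₀pos : 0 < s₀ := by
    have := boltzmannVar_pos hD h0
    have := Real.pi_pos
    positivity
  have hllt : ∀ k s : ℕ, Tendsto (fun n : ℕ => √n * shiftedProb D (x n) n (m n) k s) atTop
      (𝓝 s₀) := by
    intro k s
    refine (tendsto_sqrt_mul_sumProb hD hgcd hx h0 hm hm' k s).congr' ?_
    filter_upwards [hm'.eventually_ge_atTop s] with n hn
    rw [shiftedProb, if_pos (by omega)]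
  have hP : ∀ᶠ n : ℕ in atTop, s₀ / 2 < √n * sumProb D n (x n) (2 * m n) := by
    have h := hllt 0 0
    simp only [shiftedProb_zero] at h
    exact h.eventually (lt_mem_nhds (half_lt_self hs₀pos))
  obtain ⟨c, hc, hbound⟩ := norm_charFn_le hD.nonempty hgcd (half_pos h0)
    (show x₀ / 2 ≤ 2 * x₀ by linarith)
  have hxa : ∀ᶠ n in atTop, x₀ / 2 ≤ x n :=
    (hx.eventually (lt_mem_nhds (half_lt_self h0))).mono fun n h => h.le
  have hxb : ∀ᶠ n in atTop, x n ≤ 2 * x₀ :=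
    (hx.eventually (gt_mem_nhds (show x₀ < 2 * x₀ by linarith))).mono fun n h => h.le
  set C := max 1 ((2 * Real.pi)⁻¹ * √(Real.pi / c)) with hC
  have hC1 : 1 ≤ C := le_max_left _ _
  set C' := C / (s₀ / 2) with hC'
  have hC'0 : 0 < C' := by positivity
  -- M is chosen so that C' + 1 ≤ ε 2^M, where the 1 accounts for the limit being subtracted.
  obtain ⟨M, hM⟩ := exists_pow_lt_of_lt_one (y := (1 / 2 : ℝ)) (x := ε / (C' + 1))
    (by positivity) (by norm_num)
  have hlim : ∀ q : (ℕ × ℕ) × ℕ, Tendsto (fun n : ℕ => correction D (x n) n (m n) q /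
      sumProb D n (x n) (2 * m n)) atTop (𝓝 1) := by
    intro q
    have h1 := (tendsto_vertexCorrection q.1.1).mul ((tendsto_edgeCorrection q.1.2).comp hm')
    have h2 := (hllt q.1.1 (2 * q.1.2 + q.2)).div (hllt 0 0) hs₀pos.ne'
    have h3 := h1.mul h2
    rw [mul_one, div_self hs₀pos.ne', mul_one] at h3
    refine h3.congr' ?_
    filter_upwards [eventually_gt_atTop 0] with n hn
    have hs : √(n : ℝ) ≠ 0 := (Real.sqrt_pos.2 (Nat.cast_pos.2 hn)).ne'
    rw [Pi.div_apply, shiftedProb_zero, mul_div_mul_left _ _ hs, correction, Function.comp_apply,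
      mul_div_assoc]
  have hfin : ∀ᶠ n in atTop, ∀ q ∈ (Finset.range M ×ˢ Finset.range M) ×ˢ Finset.range M,
      |correction D (x n) n (m n) q / sumProb D n (x n) (2 * m n) - 1| < ε := by
    rw [Filter.eventually_all_finset]
    intro q _
    have := (hlim q).sub_const 1
    rw [sub_self] at this
    simpa using this.abs.eventually (gt_mem_nhds (by simpa using hε))
  filter_upwards [hP, hxa, hxb, hfin, eventually_gt_atTop 0] with n hn1 hn2 hn3 hn4 hn5 q
  have hx0 : 0 ≤ x n := (half_pos h0).le.trans hn2
  have hs : 0 < √(n : ℝ) := Real.sqrt_pos.2 (Nat.cast_pos.2 hn5)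
  have hPpos : 0 < sumProb D n (x n) (2 * m n) :=
    pos_of_mul_pos_right ((half_pos hs₀pos).trans hn1) hs.le
  set P := sumProb D n (x n) (2 * m n) with hPdef
  have hmaj : (1 : ℝ) ≤ majorant q := by
    unfold majorant
    have h1 : (1 : ℝ) ≤ 32 ^ q.1.1 := one_le_pow₀ (by norm_num)
    have h2 : (1 : ℝ) ≤ 32 ^ q.1.2 := one_le_pow₀ (by norm_num)
    have h3 : (1 : ℝ) ≤ 2 ^ q.2 := one_le_pow₀ (by norm_num)
    exact one_le_mul_of_one_le_of_one_le (one_le_mul_of_one_le_of_one_le h1 h2) h3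
  suffices h : |correction D (x n) n (m n) q / P - 1| ≤ ε * majorant q by
    have h1 : correction D (x n) n (m n) q - P =
        P * (correction D (x n) n (m n) q / P - 1) := by field_simp
    rw [h1, abs_mul, abs_of_pos hPpos]
    calc P * |correction D (x n) n (m n) q / P - 1| ≤ P * (ε * majorant q) := by gcongr
      _ = _ := by ring
  by_cases hq : q ∈ (Finset.range M ×ˢ Finset.range M) ×ˢ Finset.range M
  · calc _ ≤ ε * 1 := by rw [mul_one]; exact (hn4 q hq).le
      _ ≤ _ := by gcongr
  · have hMq : M ≤ q.1.1 + q.1.2 + q.2 := by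
      simp only [Finset.mem_product, Finset.mem_range, not_and_or, not_lt] at hq
      omega
    have hnn : 0 ≤ correction D (x n) n (m n) q :=
      mul_nonneg (mul_nonneg (vertexCorrection_nonneg _ _) (edgeCorrection_nonneg _ _))
        (shiftedProb_nonneg hx0 _ _ _ _)
    have hle : correction D (x n) n (m n) q / P ≤ C' * (2 ^ q.1.1 * 8 ^ q.1.2) := by
      rw [div_le_iff₀ hPpos]
      have h1 := shiftedProb_le (D := D) hC1 (fun N hN j =>
        (sumProb_le hx0 hc (hbound (x n) hn2 hn3) hN j).trans
          (by gcongr; exact le_max_right _ _)) hn5 (m n) q.1.1 (2 * q.1.2 + q.2)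
      have h2 : C / √n ≤ C' * P := by
        rw [div_le_iff₀ hs, hC', div_mul_eq_mul_div, div_mul_eq_mul_div,
          le_div_iff₀ (half_pos hs₀pos), mul_assoc, mul_comm P]
        gcongr
      calc correction D (x n) n (m n) q ≤ 1 * 8 ^ q.1.2 * (C * 2 ^ q.1.1 / √n) :=
            mul_le_mul (mul_le_mul (vertexCorrection_le_one _ _) (edgeCorrection_le _ _)
              (edgeCorrection_nonneg _ _) zero_le_one) h1 (shiftedProb_nonneg hx0 _ _ _ _)
              (by positivity)
        _ = (2 ^ q.1.1 * 8 ^ q.1.2) * (C / √n) := by ring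
        _ ≤ (2 ^ q.1.1 * 8 ^ q.1.2) * (C' * P) := by gcongr
        _ = _ := by ring
    have hone : (1 : ℝ) ≤ 2 ^ q.1.1 * 8 ^ q.1.2 :=
      one_le_mul_of_one_le_of_one_le (one_le_pow₀ (by norm_num)) (one_le_pow₀ (by norm_num))
    have hmaj2 : (2 ^ q.1.1 * 8 ^ q.1.2 : ℝ) * 2 ^ M ≤ majorant q := by
      calc (2 ^ q.1.1 * 8 ^ q.1.2 : ℝ) * 2 ^ M
          ≤ 2 ^ q.1.1 * 8 ^ q.1.2 * 2 ^ (q.1.1 + q.1.2 + q.2) := by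
            gcongr
            norm_num
        _ = 4 ^ q.1.1 * 16 ^ q.1.2 * 2 ^ q.2 := by
            rw [show (4 : ℝ) = 2 * 2 by norm_num, show (16 : ℝ) = 8 * 2 by norm_num, mul_pow,
              mul_pow]
            ring
        _ ≤ _ := by unfold majorant; gcongr <;> norm_num
    have hM' : C' + 1 ≤ ε * 2 ^ M := by
      rw [one_div, inv_pow, inv_lt_comm₀ (by positivity) (by positivity), inv_div,
        div_lt_iff₀ hε] at hM
      linarith
    calc |correction D (x n) n (m n) q / P - 1|
        ≤ |correction D (x n) n (m n) q / P| + |(1 : ℝ)| := abs_sub _ _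
      _ ≤ C' * (2 ^ q.1.1 * 8 ^ q.1.2) + 2 ^ q.1.1 * 8 ^ q.1.2 := by
          rw [abs_one, abs_of_nonneg (div_nonneg hnn hPpos.le)]
          gcongr
      _ = (C' + 1) * (2 ^ q.1.1 * 8 ^ q.1.2) := by ring
      _ ≤ ε * 2 ^ M * (2 ^ q.1.1 * 8 ^ q.1.2) := by gcongr
      _ = ε * (2 ^ q.1.1 * 8 ^ q.1.2 * 2 ^ M) := by ring
      _ ≤ _ := by gcongr

/-! ### The generating function as a sum over vertices, edges and further half-edges -/

/-- The term of `F(z, w, (Δ(x), Δ'(x), …))` with `z ^ k`, `w ^ l` and `x ^ r`. -/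
def tripleTerm (𝓕 : Family) (D : Set ℕ) (z w x : ℝ) (q : (ℕ × ℕ) × ℕ) : ℝ :=
  ((PowerSeries.coeff q.2 (familyPolyDelta 𝓕 D q.1.1 q.1.2) : ℚ) : ℝ) * x ^ q.2 *
    w ^ q.1.2 * z ^ q.1.1

theorem tripleTerm_nonneg (𝓕 : Family) (D : Set ℕ) {z w x : ℝ} (hz : 0 ≤ z) (hw : 0 ≤ w)
    (hx : 0 ≤ x) (q : (ℕ × ℕ) × ℕ) : 0 ≤ tripleTerm 𝓕 D z w x q := by
  have h : (0 : ℝ) ≤ ((PowerSeries.coeff q.2 (familyPolyDelta 𝓕 D q.1.1 q.1.2) : ℚ) : ℝ) := by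
    exact_mod_cast familyPolyDelta_mem_nonnegSeries 𝓕 D q.1.1 q.1.2 q.2
  unfold tripleTerm
  positivity

/-- Each term of the double series is expanded in powers of x; nonnegativity makes the resulting
triple series summable. -/
theorem hasSum_tripleTerm {𝓕 : Family} {D : Set ℕ} {z w x : ℝ} (hz : 0 ≤ z) (hw : 0 ≤ w)
    (hx : 0 ≤ x) (h : Summable (familyTerm 𝓕 z w (DeltaDerivs ℝ D x))) :
    HasSum (tripleTerm 𝓕 D z w x) (familyValue 𝓕 z w (DeltaDerivs ℝ D x)) := by
  have h1 : ∀ p : ℕ × ℕ, HasSum (fun r => tripleTerm 𝓕 D z w x (p, r))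
      (familyTerm 𝓕 z w (DeltaDerivs ℝ D x) p) := fun p =>
    ((hasEval_familyPolyDelta 𝓕 D p.1 p.2 x).2.mul_right (w ^ p.2)).mul_right (z ^ p.1)
  have h2 : Summable (tripleTerm 𝓕 D z w x) := by
    refine (summable_prod_of_nonneg fun q => tripleTerm_nonneg 𝓕 D hz hw hx q).2
      ⟨fun p => (h1 p).summable, ?_⟩
    simpa only [(h1 _).tsum_eq] using h
  have h3 := h2.hasSum
  have h4 := h3.prod_fiberwise h1
  rwa [h4.tsum_eq.symm] at h3

theorem familyTerm_ofReal (𝓕 : Family) (D : Set ℕ) (z w x : ℝ) (p : ℕ × ℕ) :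
    familyTerm 𝓕 (z : ℂ) (w : ℂ) (DeltaDerivs ℂ D x) p =
      ((familyTerm 𝓕 z w (DeltaDerivs ℝ D x) p : ℝ) : ℂ) := by
  have h : DeltaDerivs ℂ D (x : ℂ) = algebraMap ℝ ℂ ∘ DeltaDerivs ℝ D x := by
    ext s
    rw [Function.comp_apply, deltaDerivs_eq, deltaDerivs_eq, delta_ofReal]
    rfl
  rw [familyTerm, familyTerm, h, MvPolynomial.aeval_algebraMap_apply]
  push_cast
  rfl

theorem familyValue_ofReal (𝓕 : Family) (D : Set ℕ) (z w x : ℝ) :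
    familyValue 𝓕 (z : ℂ) (w : ℂ) (DeltaDerivs ℂ D x) =
      ((familyValue 𝓕 z w (DeltaDerivs ℝ D x) : ℝ) : ℂ) := by
  simp only [familyValue, familyTerm_ofReal, Complex.ofReal_tsum]

theorem atSaddle_ofReal {β : Type} (Φ : ℂ → ℂ → (ℕ → ℂ) → β) (D : Set ℕ) (n m : ℕ)
    (χ z w x : ℝ) :
    atSaddle Φ D n m (χ : ℂ) (z : ℂ) (w : ℂ) (x : ℂ) =
      Φ ((n * z / Delta ℝ D (x * χ) : ℝ) : ℂ) ((w * (x * χ) ^ 2 / (2 * m) : ℝ) : ℂ)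
        (DeltaDerivs ℂ D ((x * χ : ℝ) : ℂ)) := by
  rw [atSaddle, ← Complex.ofReal_mul, delta_ofReal]
  push_cast
  rfl

theorem summable_atSaddle_iff (𝓕 : Family) (D : Set ℕ) (n m : ℕ) (χ z w x : ℝ) :
    Summable (atSaddle (familyTerm 𝓕) D n m (χ : ℂ) (z : ℂ) (w : ℂ) (x : ℂ)) ↔
      Summable (familyTerm 𝓕 (n * z / Delta ℝ D (x * χ)) (w * (x * χ) ^ 2 / (2 * (m : ℝ)))
        (DeltaDerivs ℝ D (x * χ))) := by
  rw [atSaddle_ofReal, ← Complex.summable_ofReal]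
  simp only [← familyTerm_ofReal]

theorem atSaddle_familyValue (𝓕 : Family) (D : Set ℕ) (n m : ℕ) (χ z w x : ℝ) :
    atSaddle (familyValue 𝓕) D n m (χ : ℂ) (z : ℂ) (w : ℂ) (x : ℂ) =
      ((familyValue 𝓕 (n * z / Delta ℝ D (x * χ)) (w * (x * χ) ^ 2 / (2 * (m : ℝ)))
        (DeltaDerivs ℝ D (x * χ)) : ℝ) : ℂ) := by
  rw [atSaddle_ofReal, familyValue_ofReal]

/-- An exact identity: the correction collects all that distinguishes falling factorials from powers
and the coefficient of Δ^(n−k) from Δ(x)^(n−k) / x^(2(m−l)−r). -/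
theorem countDistinguished_eq_tripleTerm (𝓕 : Family) {D : Set ℕ} {n m : ℕ} (hn : 0 < n)
    (hm : 0 < m) {x : ℝ} (hx : 0 < x) (hΔ : 0 < Delta ℝ D x) {k l r : ℕ} (hk : k ≤ n) (hl : l ≤ m)
    (hr : r ≤ 2 * (m - l)) :
    (n.choose k * m.choose l : ℝ) * (2 ^ l * l.factorial * k.factorial *
        (2 * (m - l)).factorial * (((PowerSeries.coeff r (familyPolyDelta 𝓕 D k l) : ℚ) : ℝ) *
          ((PowerSeries.coeff (2 * (m - l) - r) (deltaSeries D ^ (n - k)) : ℚ) : ℝ))) =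
      (2 * m).factorial * Delta ℝ D x ^ n / x ^ (2 * m) *
        (tripleTerm 𝓕 D (n / Delta ℝ D x) (x ^ 2 / (2 * m)) x ((k, l), r) *
          correction D x n m ((k, l), r)) := by
  have hs : 2 * l + r ≤ 2 * m := by omega
  have e : 2 * m - (2 * l + r) = 2 * (m - l) - r := by omega
  have hn' : (n : ℝ) ≠ 0 := (Nat.cast_pos.2 hn).ne'
  have hm' : (m : ℝ) ≠ 0 := (Nat.cast_pos.2 hm).ne'
  have hx2 : x ^ (2 * m) = x ^ (2 * (m - l) - r) * x ^ (2 * l) * x ^ r := by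
    rw [← pow_add, ← pow_add]; congr 1; omega
  have hΔn : Delta ℝ D x ^ n = Delta ℝ D x ^ (n - k) * Delta ℝ D x ^ k := by
    rw [← pow_add]; congr 1; omega
  have hf : ((2 * m).factorial : ℝ) ≠ 0 := Nat.cast_ne_zero.2 (Nat.factorial_ne_zero _)
  simp only [correction, shiftedProb, if_pos hs, e, tripleTerm, sumProb, vertexCorrection,
    edgeCorrection]
  rw [Nat.descFactorial_eq_factorial_mul_choose, Nat.descFactorial_eq_factorial_mul_choose, hx2,
    hΔn, div_pow, div_pow, ← pow_mul]
  push_cast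
  field_simp

theorem hasSum_countDistinguished (𝓕 : Family) {D : Set ℕ} (hD : D.Nonempty) {n m : ℕ}
    (hn : 0 < n) (hm : 0 < m) {x : ℝ} (hx : 0 < x) :
    HasSum (fun q => (2 * m).factorial * Delta ℝ D x ^ n / x ^ (2 * m) *
      (tripleTerm 𝓕 D (n / Delta ℝ D x) (x ^ 2 / (2 * m)) x q * correction D x n m q))
      (countDistinguished 𝓕 n m D : ℝ) := by
  have hΔ := delta_pos hD hx
  have hzero : ∀ k l r, (n < k ∨ m < l ∨ 2 * (m - l) < r) →
      correction D x n m ((k, l), r) = 0 := by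
    rintro k l r (h | h | h)
    · simp [correction, vertexCorrection, Nat.descFactorial_of_lt h]
    · simp [correction, edgeCorrection, Nat.descFactorial_of_lt h]
    -- For l > m the truncated m − l says nothing about the probability, but then the edge
    -- correction vanishes.
    · by_cases hl : l ≤ m
      · have : ¬ 2 * l + r ≤ 2 * m := by omega
        simp [correction, shiftedProb, this]
      · simp [correction, edgeCorrection, Nat.descFactorial_of_lt (not_le.1 hl)]
  have h := congrArg (Rat.cast : ℚ → ℝ) (countDistinguished_eq 𝓕 n m D)
  simp only [Rat.cast_natCast, Rat.cast_sum, Rat.cast_mul, Rat.cast_pow, Rat.cast_ofNat] at h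
  have hsum : (countDistinguished 𝓕 n m D : ℝ) =
      ∑ q ∈ (Finset.range (n + 1) ×ˢ Finset.range (m + 1)) ×ˢ Finset.range (2 * m + 1),
        (2 * m).factorial * Delta ℝ D x ^ n / x ^ (2 * m) *
      (tripleTerm 𝓕 D (n / Delta ℝ D x) (x ^ 2 / (2 * m)) x q * correction D x n m q) := by
    rw [h, Finset.sum_product, Finset.sum_product]
    refine Finset.sum_congr rfl fun k hk => Finset.sum_congr rfl fun l hl => ?_
    rw [Finset.mem_range, Nat.lt_succ_iff] at hk hl
    rw [PowerSeries.coeff_mul, Finset.Nat.sum_antidiagonal_eq_sum_range_succ_mk, Rat.cast_sum,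
      Finset.mul_sum, Finset.mul_sum]
    refine Eq.trans ?_ (Finset.sum_subset (s₁ := Finset.range (2 * (m - l) + 1)) ?_ ?_)
    · refine Finset.sum_congr rfl fun r hr => ?_
      rw [Finset.mem_range, Nat.lt_succ_iff] at hr
      rw [Rat.cast_mul]
      exact countDistinguished_eq_tripleTerm 𝓕 hn hm hx hΔ hk hl hr
    · intro r hr
      rw [Finset.mem_range] at hr ⊢
      omega
    · intro r _ hr
      rw [Finset.mem_range, Nat.lt_succ_iff, not_le] at hr
      rw [hzero k l r (Or.inr (Or.inr hr)), mul_zero, mul_zero]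
  rw [hsum]
  refine hasSum_sum_of_ne_finset_zero ?_
  rintro ⟨⟨k, l⟩, r⟩ hq
  simp only [Finset.mem_product, Finset.mem_range, not_and_or, not_lt] at hq
  rw [hzero k l r (by omega), mul_zero, mul_zero]

theorem countMG_eq_sumProb {D : Set ℕ} (hD : D.Nonempty) (n m : ℕ) {x : ℝ} (hx : 0 < x) :
    (countMG n m D : ℝ) =
      (2 * m).factorial * Delta ℝ D x ^ n / x ^ (2 * m) * sumProb D n x (2 * m) := by
  have h := congrArg (Rat.cast : ℚ → ℝ) (countMG_eq n m D)
  have hΔ := (delta_pos hD hx).ne'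
  rw [Rat.cast_natCast, Rat.cast_mul, Rat.cast_natCast] at h
  rw [h, sumProb]
  field_simp

/-! ### The asymptotics -/

theorem abs_countDistinguished_sub_le (𝓕 : Family) {D : Set ℕ} (hD : D.Nonempty) {n m : ℕ}
    (hn : 0 < n) (hm : 0 < m) {x : ℝ} (hx : 0 < x) {ε V H : ℝ}
    (hcorr : ∀ q, |correction D x n m q - sumProb D n x (2 * m)| ≤
      ε * sumProb D n x (2 * m) * majorant q)
    (hV : HasSum (tripleTerm 𝓕 D (n / Delta ℝ D x) (x ^ 2 / (2 * m)) x) V)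
    (hH : HasSum (fun q => tripleTerm 𝓕 D (n / Delta ℝ D x) (x ^ 2 / (2 * m)) x q * majorant q)
      H) :
    |(countDistinguished 𝓕 n m D : ℝ) - countMG n m D * V| ≤ ε * countMG n m D * H := by
  have hΔ := delta_pos hD hx
  set Q := (2 * m).factorial * Delta ℝ D x ^ n / x ^ (2 * m) with hQ
  have hQ0 : 0 ≤ Q := by positivity
  set P := sumProb D n x (2 * m) with hP
  have h1 := (hasSum_countDistinguished 𝓕 hD hn hm hx).sub (hV.mul_left (Q * P))
  rw [countMG_eq_sumProb hD n m hx, ← h1.tsum_eq, ← Real.norm_eq_abs]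
  refine tsum_of_norm_bounded (hH.mul_left (ε * (Q * P))) fun q => ?_
  have hT := tripleTerm_nonneg 𝓕 D (z := n / Delta ℝ D x) (w := x ^ 2 / (2 * m)) (x := x)
    (by positivity) (by positivity) hx.le q
  set T := tripleTerm 𝓕 D (n / Delta ℝ D x) (x ^ 2 / (2 * m)) x q
  rw [show Q * (T * correction D x n m q) - Q * P * T = Q * T * (correction D x n m q - P) by ring,
    norm_mul, Real.norm_of_nonneg (mul_nonneg hQ0 hT), Real.norm_eq_abs]
  calc Q * T * |correction D x n m q - P| ≤ Q * T * (ε * P * majorant q) := by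
        gcongr
        exact hcorr q
    _ = _ := by ring

/-- Multiplying by a geometric majorant amounts to rescaling z, w and x. -/
theorem tripleTerm_mul_majorant_le (𝓕 : Family) (D : Set ℕ) {z w x z' w' : ℝ} (hz : 0 ≤ z)
    (hw : 0 ≤ w) (hx : 0 ≤ x) (hz' : 32 * z ≤ z') (hw' : 32 * w ≤ w') (q : (ℕ × ℕ) × ℕ) :
    tripleTerm 𝓕 D z w x q * majorant q ≤ tripleTerm 𝓕 D z' w' (2 * x) q := by
  have h : (0 : ℝ) ≤ ((PowerSeries.coeff q.2 (familyPolyDelta 𝓕 D q.1.1 q.1.2) : ℚ) : ℝ) := by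
    exact_mod_cast familyPolyDelta_mem_nonnegSeries 𝓕 D q.1.1 q.1.2 q.2
  have hw'0 : 0 ≤ w' := (mul_nonneg (by norm_num) hw).trans hw'
  unfold tripleTerm majorant
  calc _ = ((PowerSeries.coeff q.2 (familyPolyDelta 𝓕 D q.1.1 q.1.2) : ℚ) : ℝ) *
        (2 * x) ^ q.2 * (32 * w) ^ q.1.2 * (32 * z) ^ q.1.1 := by
        rw [mul_pow, mul_pow, mul_pow]; ring
    _ ≤ _ := by gcongr

theorem exists_majorant_sum (𝓕 : Family) (D : Set ℕ) {z w x z' w' V V' C : ℝ} (hz : 0 ≤ z)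
    (hw : 0 ≤ w) (hx : 0 ≤ x) (hz' : 32 * z ≤ z') (hw' : 32 * w ≤ w')
    (hV : HasSum (tripleTerm 𝓕 D z w x) V) (hV' : HasSum (tripleTerm 𝓕 D z' w' (2 * x)) V')
    (hVV' : |V' / V| ≤ C) :
    ∃ H, HasSum (fun q => tripleTerm 𝓕 D z w x q * majorant q) H ∧ H ≤ C * V := by
  have hnn := tripleTerm_nonneg 𝓕 D hz hw hx
  have hle := tripleTerm_mul_majorant_le 𝓕 D hz hw hx hz' hw'
  have hmaj : ∀ q, 0 ≤ majorant q := fun q => by unfold majorant; positivity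
  have hsum : Summable fun q => tripleTerm 𝓕 D z w x q * majorant q :=
    Summable.of_nonneg_of_le (fun q => mul_nonneg (hnn q) (hmaj q)) hle hV'.summable
  refine ⟨_, hsum.hasSum, ?_⟩
  -- If V = 0, the quotient is 0 by convention and bounds nothing, but then all the nonnegative
  -- terms vanish.
  rcases (hV.nonneg hnn).eq_or_lt with h0 | h0
  · rw [← h0] at hV
    have h1 := (hasSum_zero_iff_of_nonneg hnn).1 hV
    simp [h1, ← h0]
  · calc ∑' q, tripleTerm 𝓕 D z w x q * majorant q ≤ V' := hasSum_le hle hsum.hasSum hV'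
      _ ≤ C * V := by
        rw [← div_le_iff₀ h0]
        exact (le_abs_self _).trans hVV'

theorem countDistinguished_isEquivalent (𝓕 : Family) {D : Set ℕ} (hD : D.Nontrivial)
    (hgcd : ∀ g : ℕ, (∀ d ∈ D, g ∣ d - sInf D) → g = 1) {m : ℕ → ℕ} {lam : ℝ}
    (hlam : Tendsto (fun n : ℕ => 2 * (m n : ℝ) / (n : ℝ)) atTop (𝓝 lam))
    (h₁ : ((sInf D : ℕ) : ℝ) < lam) (h₂ : ∃ d ∈ D, lam < (d : ℝ)) {χ : ℕ → ℝ}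
    (hχ : ∀ n : ℕ, χ n = chi D (2 * (m n : ℝ) / (n : ℝ)))
    (hL : ∃ L : ℂ × ℂ × ℂ → ℂ, ∀ p : ℂ × ℂ × ℂ, Delta ℂ D (p.2.2 * (chi D lam : ℂ)) ≠ 0 →
      (∀ᶠ n : ℕ in atTop,
        Summable (atSaddle (familyTerm 𝓕) D n (m n) (χ n : ℂ) p.1 p.2.1 p.2.2)) ∧
      Tendsto (fun n : ℕ => atSaddle (familyValue 𝓕) D n (m n) (χ n : ℂ) p.1 p.2.1 p.2.2 /
        atSaddle (familyValue 𝓕) D n (m n) (χ n : ℂ) 1 1 1) atTop (𝓝 (L p))) :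
    (fun n : ℕ => (countDistinguished 𝓕 n (m n) D : ℝ)) ~[atTop]
      fun n : ℕ => (countMG n (m n) D : ℝ) *
        familyValue 𝓕 ((n : ℝ) / Delta ℝ D (χ n)) (χ n ^ 2 / (2 * (m n : ℝ)))
          (DeltaDerivs ℝ D (χ n)) := by
  obtain ⟨L, hL⟩ := hL
  obtain ⟨h0, -⟩ := chi_spec h₁ h₂
  set x₀ := chi D lam with hx₀
  have hx : Tendsto χ atTop (𝓝 x₀) := by
    simpa only [← hχ] using tendsto_chi hD hlam h₁ h₂
  have hrange := eventually_mem_range hlam h₁ h₂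
  have hmean : ∀ᶠ n in atTop, mean D (χ n) = 2 * (m n : ℝ) / (n : ℝ) :=
    hrange.mono fun n hn => by rw [hχ]; exact (chi_spec hn.1 hn.2).2
  have hχpos : ∀ᶠ n in atTop, 0 < χ n :=
    hrange.mono fun n hn => by rw [hχ]; exact (chi_spec hn.1 hn.2).1
  have hlam0 : 0 < lam := (Nat.cast_nonneg _).trans_lt h₁
  have hmtop : Tendsto m atTop atTop := by
    rw [← tendsto_natCast_atTop_iff (R := ℝ)]
    have h1 := (hlam.pos_mul_atTop hlam0 tendsto_natCast_atTop_atTop).atTop_div_const two_pos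
    refine h1.congr' ?_
    filter_upwards [eventually_gt_atTop 0] with n hn
    have : (n : ℝ) ≠ 0 := (Nat.cast_pos.2 hn).ne'
    field_simp
  have hΔ₀ := delta_pos hD.nonempty h0
  have hΔ₁ := delta_pos hD.nonempty (mul_pos two_pos h0)
  -- At x = 2 the first argument has denominator Δ(2χ) instead of Δ(χ). The second factor of z₀
  -- eventually exceeds Δ(2χ)/Δ(χ), so the argument is still at least 32 n/Δ(χ).
  set z₀ : ℝ := 32 * (Delta ℝ D (2 * x₀) / Delta ℝ D x₀ + 1) with hz₀
  obtain ⟨hs1, -⟩ := hL ((1 : ℝ), (1 : ℝ), (1 : ℝ)) (by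
    rw [← Complex.ofReal_mul, delta_ofReal, Complex.ofReal_ne_zero, one_mul]
    exact hΔ₀.ne')
  obtain ⟨hs2, hlim⟩ := hL ((z₀ : ℝ), (32 : ℝ), (2 : ℝ)) (by
    rw [← Complex.ofReal_mul, delta_ofReal, Complex.ofReal_ne_zero]
    exact hΔ₁.ne')
  have hratio : ∀ᶠ n in atTop, Delta ℝ D (2 * χ n) / Delta ℝ D (χ n) <
      Delta ℝ D (2 * x₀) / Delta ℝ D x₀ + 1 := by
    have h1 : Tendsto (fun n => Delta ℝ D (2 * χ n) / Delta ℝ D (χ n)) atTop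
        (𝓝 (Delta ℝ D (2 * x₀) / Delta ℝ D x₀)) :=
      (((continuous_delta D).tendsto _).comp (hx.const_mul 2)).div
        (((continuous_delta D).tendsto _).comp hx) hΔ₀.ne'
    exact h1.eventually (gt_mem_nhds (lt_add_one _))
  set C := ‖L ((z₀ : ℝ), (32 : ℝ), (2 : ℝ))‖ + 1 with hC
  have hC0 : 0 < C := by positivity
  have hnorm : ∀ᶠ n in atTop, ‖atSaddle (familyValue 𝓕) D n (m n) (χ n : ℂ) (z₀ : ℝ)
      (32 : ℝ) (2 : ℝ) / atSaddle (familyValue 𝓕) D n (m n) (χ n : ℂ) 1 1 1‖ < C :=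
    hlim.norm.eventually (gt_mem_nhds (lt_add_one _))
  rw [IsEquivalent, isLittleO_iff]
  intro ε hε
  -- Dividing ε by C prepares for the bound C V of the majorant sum.
  have hcorr := correction_near hD hgcd hx h0 hmean hmtop (div_pos hε hC0)
  filter_upwards [hs1, hs2, hχpos, hratio, hnorm, hcorr, eventually_gt_atTop 0,
    hmtop.eventually_gt_atTop 0] with n hs1 hs2 hχn hratio hnorm hcorr hn hm
  have hΔn := delta_pos hD.nonempty hχn
  have hΔn2 := delta_pos hD.nonempty (mul_pos two_pos hχn)
  rw [summable_atSaddle_iff] at hs1 hs2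
  rw [← Complex.ofReal_one, atSaddle_familyValue, atSaddle_familyValue, ← Complex.ofReal_div,
    Complex.norm_real, Real.norm_eq_abs] at hnorm
  simp only [one_mul, mul_one] at hs1 hnorm
  have hm' : (0 : ℝ) < m n := Nat.cast_pos.2 hm
  have hn' : (0 : ℝ) < n := Nat.cast_pos.2 hn
  have hV := hasSum_tripleTerm (by positivity) (by positivity) hχn.le hs1
  have hV' := hasSum_tripleTerm (by positivity) (by positivity) (by positivity) hs2
  set V := familyValue 𝓕 ((n : ℝ) / Delta ℝ D (χ n)) (χ n ^ 2 / (2 * (m n : ℝ)))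
    (DeltaDerivs ℝ D (χ n)) with hVdef
  obtain ⟨H, hH, hHV⟩ := exists_majorant_sum 𝓕 D (by positivity) (by positivity) hχn.le
    (by
      rw [hz₀, le_div_iff₀ hΔn2]
      rw [div_lt_iff₀ hΔn] at hratio
      calc 32 * ((n : ℝ) / Delta ℝ D (χ n)) * Delta ℝ D (2 * χ n)
          ≤ 32 * ((n : ℝ) / Delta ℝ D (χ n)) *
            ((Delta ℝ D (2 * x₀) / Delta ℝ D x₀ + 1) * Delta ℝ D (χ n)) := by gcongr
        _ = _ := by
          rw [show 32 * ((n : ℝ) / Delta ℝ D (χ n)) *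
            ((Delta ℝ D (2 * x₀) / Delta ℝ D x₀ + 1) * Delta ℝ D (χ n)) =
            n * (32 * (Delta ℝ D (2 * x₀) / Delta ℝ D x₀ + 1)) *
              (Delta ℝ D (χ n) / Delta ℝ D (χ n)) by ring, div_self hΔn.ne', mul_one])
    (by
      -- At x = 2 the factor (2χ)² already enlarges the second argument fourfold, so w = 32 is
      -- ample.
      rw [mul_pow]
      have : 0 ≤ 32 * (χ n ^ 2 / (2 * (m n : ℝ))) := by positivity
      calc 32 * (χ n ^ 2 / (2 * (m n : ℝ))) ≤ 4 * (32 * (χ n ^ 2 / (2 * (m n : ℝ)))) := by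
            linarith
        _ = 32 * (2 ^ 2 * χ n ^ 2) / (2 * (m n : ℝ)) := by ring)
    hV hV' hnorm.le
  have key := abs_countDistinguished_sub_le 𝓕 hD.nonempty hn hm hχn hcorr hV hH
  have hV0 : 0 ≤ V := hV.nonneg (tripleTerm_nonneg 𝓕 D (by positivity) (by positivity) hχn.le)
  rw [Pi.sub_apply, Real.norm_eq_abs, Real.norm_of_nonneg (by positivity)]
  calc _ ≤ ε / C * countMG n (m n) D * H := key
    _ ≤ ε / C * countMG n (m n) D * (C * V) := by gcongr
    _ = _ := by field_simp

end DistinguishedSubgraph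

end

theorem mainTheorem6 (𝓕 : DistinguishedSubgraph.Family) (D : Set ℕ) :
    -- the exact formula
    (∀ n m : ℕ,
      (DistinguishedSubgraph.countDistinguished 𝓕 n m D : ℚ) =
        (n.factorial : ℚ) * 2 ^ m * (m.factorial : ℚ) *
          PowerSeries.coeff m (PowerSeries.coeff n
            (DistinguishedSubgraph.halfEdgeSum
              (DistinguishedSubgraph.familySeriesDelta 𝓕 D *
                DistinguishedSubgraph.expZDelta D)))) ∧
    -- the asymptotics
    (D.Nontrivial →
      (∀ g : ℕ, (∀ d ∈ D, g ∣ d - sInf D) → g = 1) →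
      ∀ (m : ℕ → ℕ) (lam : ℝ),
        Tendsto (fun n : ℕ => 2 * (m n : ℝ) / (n : ℝ)) atTop (𝓝 lam) →
        ((sInf D : ℕ) : ℝ) < lam →
        (∃ d ∈ D, lam < (d : ℝ)) →
        ∀ χ : ℕ → ℝ,
          (∀ n : ℕ, χ n = DistinguishedSubgraph.chi D (2 * (m n : ℝ) / (n : ℝ))) →
          -- locally uniform convergence of the quotient where `Δ(x χ)` does not vanish
          (∃ L : ℂ × ℂ × ℂ → ℂ,
            AnalyticOnNhd ℂ L {p : ℂ × ℂ × ℂ | DistinguishedSubgraph.Delta ℂ D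
              (p.2.2 * (DistinguishedSubgraph.chi D lam : ℂ)) ≠ 0} ∧
            ∀ K : Set (ℂ × ℂ × ℂ), IsCompact K →
              K ⊆ {p : ℂ × ℂ × ℂ | DistinguishedSubgraph.Delta ℂ D
                (p.2.2 * (DistinguishedSubgraph.chi D lam : ℂ)) ≠ 0} →
              (∀ᶠ n : ℕ in atTop, ∀ p ∈ K,
                Summable (DistinguishedSubgraph.atSaddle
                  (DistinguishedSubgraph.familyTerm 𝓕) D n (m n) (χ n : ℂ) p.1 p.2.1 p.2.2)) ∧
              TendstoUniformlyOn
                (fun (n : ℕ) (p : ℂ × ℂ × ℂ) =>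
                  DistinguishedSubgraph.atSaddle (DistinguishedSubgraph.familyValue 𝓕)
                      D n (m n) (χ n : ℂ) p.1 p.2.1 p.2.2 /
                    DistinguishedSubgraph.atSaddle (DistinguishedSubgraph.familyValue 𝓕)
                      D n (m n) (χ n : ℂ) 1 1 1)
                L atTop K) →
          (fun n : ℕ => (DistinguishedSubgraph.countDistinguished 𝓕 n (m n) D : ℝ)) ~[atTop]
            fun n : ℕ => (DistinguishedSubgraph.countMG n (m n) D : ℝ) *
              DistinguishedSubgraph.familyValue 𝓕
                ((n : ℝ) / DistinguishedSubgraph.Delta ℝ D (χ n))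
                (χ n ^ 2 / (2 * (m n : ℝ)))
                (DistinguishedSubgraph.DeltaDerivs ℝ D (χ n))) := by
  refine ⟨DistinguishedSubgraph.countDistinguished_formula 𝓕 D, ?_⟩
  rintro hD hgcd m lam hlam h₁ h₂ χ hχ ⟨L, -, hL⟩
  refine DistinguishedSubgraph.countDistinguished_isEquivalent 𝓕 hD hgcd hlam h₁ h₂ hχ
    ⟨L, fun p hp => ?_⟩
  -- The compact set is a single point: the argument evaluates the quotient at individual real
  -- points.
  obtain ⟨hs, hu⟩ := hL {p} isCompact_singleton (Set.singleton_subset_iff.2 hp)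
  exact ⟨hs.mono fun n hn => hn p rfl, hu.tendsto_at rfl⟩
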